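/- Let $G$ be a finite simple graph without odd cycles of length 5 or longer, and let $\Delta$ be its maximum degree. Then the line graph $L(G)$ has a proper Galvin orientation with respect to $k=\Delta+1$. That is, there exist a partition of $V(G)$ into two (possibly empty) sets $U$ and $D$ and a $k$-edge-colouring $\varphi\colon E(G)\to\{1,\dots,k\}$ (edges sharing an end receive different colours) such that the following orientation of $L(G)$ is kernel-perfect and has outdegree at most $k-1=\Delta$ at every vertex: for edges $e,f$ of $G$ sharing an end $v$, with $\varphi(e)<\varphi(f)$, the edge of $L(G)$ joining them is directed from $f$ to $e$ if $v\in D$, and from $e$ to $f$ if $v\in U$. Here a kernel of a digraph is an independent set $K$ such that every vertex outside $K$ has at least one arc into $K$, and a digraph is kernel-perfect if every induced subdigraph has a kernel. -/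

import Mathlib

namespace Digraph

variable {α : Type*}

/-- The subdigraph of `H` induced on the vertex set `S`. -/
def inducedOn (H : Digraph α) (S : Set α) : Digraph S where
  Adj a b := H.Adj a b

/-- A kernel: an independent set `K` such that every vertex outside `K` has an arc into `K`. -/
def IsKernel (H : Digraph α) (K : Set α) : Prop :=
  (∀ a ∈ K, ∀ b ∈ K, ¬ H.Adj a b) ∧ ∀ a, a ∉ K → ∃ b ∈ K, H.Adj a b

/-- A digraph is kernel-perfect if every induced subdigraph has a kernel. -/
def IsKernelPerfect (H : Digraph α) : Prop :=
  ∀ S : Set α, ∃ K : Set S, (H.inducedOn S).IsKernel K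

/-- The number of out-neighbours of a vertex. -/
noncomputable def outdegree (H : Digraph α) (a : α) : ℕ∞ :=
  {b | H.Adj a b}.encard

end Digraph

namespace SimpleGraph

variable {V : Type*}

/-- A `k`-edge-colouring of `G`: a proper vertex colouring of the line graph. The ordered set of
colours `{1, …, k}` is represented by `Fin k`. -/
abbrev EdgeColouring (G : SimpleGraph V) (k : ℕ) := G.lineGraph.Coloring (Fin k)

/-- The Galvin orientation of the line graph of `G` with respect to `U`, `D` and the edge-colouring
`φ`: if `e` and `f` meet in a vertex of `D`, the arc goes from the higher to the lower colour; if
they meet in a vertex of `U`, it goes from the lower to the higher colour. -/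
def galvinOrientation (G : SimpleGraph V) (U D : Set V) {k : ℕ} (φ : G.EdgeColouring k) :
    Digraph G.edgeSet where
  Adj e f := ∃ v : V, v ∈ (e : Sym2 V) ∧ v ∈ (f : Sym2 V) ∧
    ((v ∈ D ∧ φ f < φ e) ∨ (v ∈ U ∧ φ e < φ f))

/-- The Galvin orientation with respect to `U`, `D` and a `k`-edge-colouring is proper if it is
kernel-perfect and all its outdegrees are at most `k - 1`. -/
def IsProperGalvinOrientation (G : SimpleGraph V) (U D : Set V) {k : ℕ}
    (φ : G.EdgeColouring k) : Prop :=
  (G.galvinOrientation U D φ).IsKernelPerfect ∧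
    ∀ e, (G.galvinOrientation U D φ).outdegree e ≤ ((k - 1 : ℕ) : ℕ∞)

/-- The line graph of `G` has a proper Galvin orientation with respect to `k`: there are a
partition of the vertices into (possibly empty) parts `U`, `D` and a `k`-edge-colouring of `G` whose
Galvin orientation is proper. -/
def HasProperGalvinOrientation (G : SimpleGraph V) (k : ℕ) : Prop :=
  ∃ (U D : Set V) (φ : G.EdgeColouring k),
    Disjoint U D ∧ U ∪ D = Set.univ ∧ G.IsProperGalvinOrientation U D φ

end SimpleGraph

/-! Write `d` for the maximum degree. Vertices of `D` prefer small colours and vertices of `U` large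
ones; kernels of the Galvin orientation are then stable matchings. An edge of colour `c` has rank
`c` at an end in `D` and `d - c` at an end in `U`, and its outdegree is at most the sum of its two
ranks. That sum is `d` for an edge across the partition, so the degree bound only asks that edges
inside `D` have colour at most `d/2` and edges inside `U` colour at least `d/2`.

For bipartite graphs this is Galvin's argument: König's colouring together with Gale-Shapley
(`hasStableMatching_of_bipartite`). In general, up to isolated vertices, a graph whose odd cycles
are triangles is bipartite, a 4-clique, or a book of triangles on a common edge, unless it splits
into two smaller graphs with at most one vertex in common (`OddCyclesAreTriangles.structure`).

The induction over splittings needs the stronger statement `RootedGalvinColourable`, in which the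
colours at a root come from a prescribed set with more than `deg r` members. One piece is coloured
first; the other is rooted at the cut vertex and avoids the colours already used there. The count
works because degrees add up at the cut vertex. Stable matchings of the two pieces are combined by
`StablyPerfect.union`. The pieces that do not split are coloured explicitly, by
`exists_isGalvinColouring_of_sinks` or `IsHub.exists_of_high`. -/

namespace SimpleGraph

/-! ### Stable matchings -/

variable {V : Type*}

/-- The edge set `S` has a stable matching (a kernel of the corresponding orientation of the line
graph) with respect to the preferences `ρ`, where `v` prefers the edges `e` with small `ρ v e`. -/
def HasStableMatching (ρ : V → Sym2 V → ℕ) (S : Set (Sym2 V)) : Prop :=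
  ∃ K ⊆ S, (∀ e ∈ K, ∀ f ∈ K, ∀ v, v ∈ e → v ∈ f → e = f) ∧
    ∀ e ∈ S, e ∉ K → ∃ f ∈ K, ∃ v, v ∈ e ∧ v ∈ f ∧ ρ v f < ρ v e

/-- Every subset of `E` has a stable matching. -/
def StablyPerfect (ρ : V → Sym2 V → ℕ) (E : Set (Sym2 V)) : Prop :=
  ∀ S ⊆ E, HasStableMatching ρ S

/-- An edge that is best at both ends lies in every stable matching, so such edges can be taken at
once and everything they touch discarded. -/
theorem HasStableMatching.of_sinks {ρ : V → Sym2 V → ℕ} {S M : Set (Sym2 V)} (hMS : M ⊆ S)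
    (hM : ∀ e ∈ M, ∀ f ∈ M, ∀ v, v ∈ e → v ∈ f → e = f)
    (hsink : ∀ m ∈ M, ∀ e ∈ S, e ≠ m → ∀ v, v ∈ m → v ∈ e → ρ v m < ρ v e)
    (hrest : HasStableMatching ρ {e ∈ S | ∀ m ∈ M, ∀ v, v ∈ e → v ∉ m}) :
    HasStableMatching ρ S := by
  obtain ⟨K, hKS, hK, hdom⟩ := hrest
  refine ⟨M ∪ K, Set.union_subset hMS fun e he => (hKS he).1, ?_, ?_⟩
  · rintro e (he | he) f (hf | hf) v hve hvf
    · exact hM e he f hf v hve hvf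
    · exact absurd hve ((hKS hf).2 e he v hvf)
    · exact absurd hvf ((hKS he).2 f hf v hve)
    · exact hK e he f hf v hve hvf
  · intro e he heK
    by_cases h : ∃ m ∈ M, ∃ v, v ∈ e ∧ v ∈ m
    · obtain ⟨m, hm, v, hve, hvm⟩ := h
      exact ⟨m, .inl hm, v, hve, hvm,
        hsink m hm e he (fun h => heK (.inl (h ▸ hm))) v hvm hve⟩
    · push Not at h
      obtain ⟨f, hf, v, h1, h2, h3⟩ := hdom e ⟨he, h⟩ fun h => heK (.inr h)
      exact ⟨f, .inr hf, v, h1, h2, h3⟩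

theorem stablyPerfect_of_exists_sink [Finite V] {ρ : V → Sym2 V → ℕ} {E : Set (Sym2 V)}
    (h : ∀ S ⊆ E, S.Nonempty →
      ∃ m ∈ S, ∀ e ∈ S, e ≠ m → ∀ v, v ∈ m → v ∈ e → ρ v m < ρ v e) :
    StablyPerfect ρ E := by
  intro S
  induction hn : S.ncard using Nat.strong_induction_on generalizing S with
  | _ n ih =>
    intro hS
    rcases S.eq_empty_or_nonempty with rfl | hne
    · exact ⟨∅, by simp, by simp, by simp⟩
    obtain ⟨m, hm, hsink⟩ := h S hS hne
    refine .of_sinks (M := {m}) (by simpa using hm) ?_ ?_ ?_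
    · rintro e rfl f rfl _ _ _; rfl
    · rintro _ rfl; exact hsink
    · have hsub : {e ∈ S | ∀ m' ∈ ({m} : Set (Sym2 V)), ∀ v, v ∈ e → v ∉ m'} ⊂ S := by
        refine ⟨fun e he => he.1, fun hh => ?_⟩
        induction m with
        | _ x y => exact (hh hm).2 _ rfl x (by simp) (by simp)
      exact ih _ (hn ▸ Set.ncard_lt_ncard hsub (Set.toFinite _)) _ rfl (hsub.subset.trans hS)

/-- The kernel theorem behind Galvin's proof: bipartite graphs have stable matchings. -/
theorem hasStableMatching_of_bipartite [Finite V] {ρ : V → Sym2 V → ℕ} (D : Set V)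
    (S : Set (Sym2 V)) (hbip : ∀ e ∈ S, ∃ x y, e = s(x, y) ∧ x ∈ D ∧ y ∉ D)
    (hinj : ∀ e ∈ S, ∀ f ∈ S, ∀ v, v ∈ e → v ∈ f → ρ v e = ρ v f → e = f) :
    HasStableMatching ρ S := by
  induction hn : S.ncard using Nat.strong_induction_on generalizing S with
  | _ n ih =>
    -- `T` consists of the favourite edges of the vertices in `D`. If they form a matching, it is
    -- stable. Otherwise two of them compete at a vertex, and the one it likes less can be deleted,
    -- as in the Gale-Shapley algorithm.
    let T : Set (Sym2 V) := {e ∈ S | ∃ x ∈ D, x ∈ e ∧ ∀ f ∈ S, x ∈ f → ρ x e ≤ ρ x f}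
    by_cases hT : ∀ e ∈ T, ∀ f ∈ T, ∀ v, v ∈ e → v ∈ f → e = f
    · refine ⟨T, fun e he => he.1, hT, fun e he heT => ?_⟩
      obtain ⟨x, y, rfl, hx, hy⟩ := hbip e he
      obtain ⟨f, ⟨hfS, hxf⟩, hmin⟩ := Set.exists_min_image {f ∈ S | x ∈ f} (ρ x)
        (Set.toFinite _) ⟨_, he, by simp⟩
      have hfT : f ∈ T := ⟨hfS, x, hx, hxf, fun g hg hxg => hmin g ⟨hg, hxg⟩⟩
      refine ⟨f, hfT, x, by simp, hxf, lt_of_le_of_ne (hmin _ ⟨he, by simp⟩) fun h => ?_⟩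
      exact heT (hinj f hfS _ he x hxf (by simp) h ▸ hfT)
    · push Not at hT
      obtain ⟨e, ⟨heS, x, hxD, hxe, hxmin⟩, f, ⟨hfS, x', hxD', hxf, hxmin'⟩, v, hve, hvf, hef⟩ := hT
      wlog hlt : ρ v f < ρ v e generalizing e f x x'
      · refine this f hfS x' hxD' hxf hxmin' e heS x hxD hxe hxmin hvf hve hef.symm ?_
        exact lt_of_le_of_ne (not_lt.1 hlt) fun h => hef (hinj e heS f hfS v hve hvf h)
      have hvx' : v ≠ x' := by
        rintro rfl
        obtain ⟨a, b, rfl, ha, hb⟩ := hbip e heS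
        have hxa : x = a := by
          rcases Sym2.mem_iff.1 hxe with h | h
          exacts [h, absurd (h ▸ hxD) hb]
        have hva : v = a := by
          rcases Sym2.mem_iff.1 hve with h | h
          exacts [h, absurd (h ▸ hxD') hb]
        subst hxa hva
        exact absurd (hxmin f hfS hvf) (not_le.2 hlt)
      have hsub : S \ {e} ⊂ S := ⟨Set.sdiff_subset, fun h => (h heS).2 rfl⟩
      obtain ⟨K, hKS, hK, hdom⟩ := ih _ (hn ▸ Set.ncard_lt_ncard hsub (Set.toFinite _)) (S \ {e})
        (fun g hg => hbip g hg.1) (fun g hg g' hg' => hinj g hg.1 g' hg'.1) rfl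
      refine ⟨K, hKS.trans hsub.subset, hK, fun g hg hgK => ?_⟩
      by_cases hge : g = e
      · subst hge
        by_cases hfK : f ∈ K
        · exact ⟨f, hfK, v, hve, hvf, hlt⟩
        -- Since `f` is the favourite of `x'`, an edge that beats `f` does so at `v`, where it then
        -- beats `e` as well.
        · obtain ⟨g', hg', w, hwf, hwg', hlt'⟩ := hdom f ⟨hfS, fun h => hef h.symm⟩ hfK
          have hf : f = s(v, x') := (Sym2.mem_and_mem_iff hvx').1 ⟨hvf, hxf⟩
          rw [hf, Sym2.mem_iff] at hwf
          rcases hwf with rfl | rfl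
          · exact ⟨g', hg', w, hve, hwg', hlt'.trans hlt⟩
          · exact absurd (hxmin' g' (hKS hg').1 hwg') (not_le.2 hlt')
      · exact hdom g ⟨hg, hge⟩ hgK

/-- Stable matchings of two edge sets that have at most the vertex `r` in common can be glued. -/
theorem StablyPerfect.union [Finite V] {ρ : V → Sym2 V → ℕ} {E₁ E₂ : Set (Sym2 V)} {r : V}
    (h₁ : StablyPerfect ρ E₁) (h₂ : StablyPerfect ρ E₂)
    (hr : ∀ e ∈ E₁, ∀ f ∈ E₂, ∀ v, v ∈ e → v ∈ f → v = r)
    (hinj : ∀ e ∈ E₁ ∪ E₂, ∀ f ∈ E₁ ∪ E₂, r ∈ e → r ∈ f → ρ r e = ρ r f → e = f) :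
    StablyPerfect ρ (E₁ ∪ E₂) := by
  intro S hS
  -- the edges at `r` that some stable matching of the side `E` can use
  let att : Set (Sym2 V) → Set (Sym2 V) := fun E => {f | r ∈ f ∧ ∃ K ⊆ {e ∈ S ∩ E | r ∈ e → ρ r e ≤ ρ r f},
    f ∈ K ∧ (∀ e ∈ K, ∀ g ∈ K, ∀ v, v ∈ e → v ∈ g → e = g) ∧
    ∀ e ∈ {e ∈ S ∩ E | r ∈ e → ρ r e ≤ ρ r f}, e ∉ K → ∃ g ∈ K, ∃ v, v ∈ e ∧ v ∈ g ∧ ρ v g < ρ v e}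
  have hattS : ∀ E, ∀ f ∈ att E, f ∈ S ∩ E := by
    rintro E f ⟨-, K, hK, hfK, -⟩
    exact (hK hfK).1
  by_cases hne : (att E₁ ∪ att E₂).Nonempty
  -- Take the best attainable edge `f` at `r`. On its own side keep the edges at `r` up to and
  -- including `f`, on the other side only those strictly better. All remaining edges at `r` are
  -- dominated by `f`.
  · obtain ⟨f, hf, hfmin⟩ := Set.exists_min_image _ (ρ r) (Set.toFinite _) hne
    wlog hf1 : f ∈ att E₁ generalizing E₁ E₂
    · have := this h₂ h₁ (fun e he f hf v hve hvf => hr f hf e he v hvf hve)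
        (by rwa [Set.union_comm E₂]) (by rwa [Set.union_comm E₂])
        (by rwa [Set.union_comm]) (by rwa [Set.union_comm]) (by rwa [Set.union_comm])
        (hf.resolve_left hf1)
      exact this
    obtain ⟨hrf, K, hKS, hfK, hK, hdom⟩ := hf1
    obtain ⟨K', hKS', hK', hdom'⟩ := h₂ {e ∈ S ∩ E₂ | r ∈ e → ρ r e < ρ r f} fun e he => he.1.2
    -- An edge of `K'` at `r` would be attainable, witnessed by `K'` itself, and better than `f`.
    have hrK' : ∀ g ∈ K', r ∉ g := by
      intro g hg hrg
      refine absurd ((hKS' hg).2 hrg) (not_lt.2 (hfmin g (.inr ⟨hrg, K', ?_, hg, hK', ?_⟩)))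
      · intro e he
        refine ⟨(hKS' he).1, fun hre => ?_⟩
        rw [hK' e he g hg r hre hrg]
      · intro e he
        exact hdom' e ⟨he.1, fun hre => (he.2 hre).trans_lt ((hKS' hg).2 hrg)⟩
    have hcross : ∀ e ∈ K, ∀ g ∈ K', ∀ v, v ∈ e → v ∉ g := by
      intro e he g hg v hve hvg
      obtain rfl := hr e (hKS he).1.2 g (hKS' hg).1.2 v hve hvg
      exact hrK' g hg hvg
    refine ⟨K ∪ K', Set.union_subset (fun e he => (hKS he).1.1) (fun e he => (hKS' he).1.1), ?_, ?_⟩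
    · rintro e (he | he) g (hg | hg) v hve hvg
      · exact hK e he g hg v hve hvg
      · exact absurd hvg (hcross e he g hg v hve)
      · exact absurd hve (hcross g hg e he v hvg)
      · exact hK' e he g hg v hve hvg
    · intro e he heK
      by_cases hbad : r ∈ e ∧ ρ r f < ρ r e
      · exact ⟨f, .inl hfK, r, hbad.1, hrf, hbad.2⟩
      push Not at hbad
      rcases hS he with he1 | he2
      · obtain ⟨g, hg, hh⟩ := hdom e ⟨⟨he, he1⟩, hbad⟩ fun h => heK (.inl h)
        exact ⟨g, .inl hg, hh⟩
      · obtain ⟨g, hg, hh⟩ := hdom' e ⟨⟨he, he2⟩, fun hre => lt_of_le_of_ne (hbad hre) fun h =>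
          heK (.inl (hinj e (.inr he2) f (.inl (hKS hfK).1.2) hre hrf h ▸ hfK))⟩ fun h => heK (.inr h)
        exact ⟨g, .inr hg, hh⟩
  -- With no attainable edge, stable matchings of the two full sides avoid `r`, so their union is a
  -- matching.
  · have key : ∀ E, StablyPerfect ρ E → att E = ∅ → ∃ K ⊆ S ∩ E, (∀ e ∈ K, r ∉ e) ∧
        (∀ e ∈ K, ∀ f ∈ K, ∀ v, v ∈ e → v ∈ f → e = f) ∧
        ∀ e ∈ S ∩ E, e ∉ K → ∃ f ∈ K, ∃ v, v ∈ e ∧ v ∈ f ∧ ρ v f < ρ v e := by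
      intro E hE hatt
      obtain ⟨K, hKS, hK, hdom⟩ := hE (S ∩ E) Set.inter_subset_right
      refine ⟨K, hKS, fun f hf hrf => ?_, hK, hdom⟩
      have : f ∈ att E := by
        refine ⟨hrf, K, fun e he => ⟨hKS he, fun hre => ?_⟩, hf, hK, fun e he => hdom e he.1⟩
        rw [hK e he f hf r hre hrf]
      simp [hatt] at this
    rw [Set.not_nonempty_iff_eq_empty, Set.union_empty_iff] at hne
    obtain ⟨K, hKS, hrK, hK, hdom⟩ := key E₁ h₁ hne.1
    obtain ⟨K', hKS', hrK', hK', hdom'⟩ := key E₂ h₂ hne.2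
    have hcross : ∀ e ∈ K, ∀ g ∈ K', ∀ v, v ∈ e → v ∉ g := by
      intro e he g hg v hve hvg
      obtain rfl := hr e (hKS he).2 g (hKS' hg).2 v hve hvg
      exact hrK' g hg hvg
    refine ⟨K ∪ K', Set.union_subset (fun e he => (hKS he).1) (fun e he => (hKS' he).1), ?_, ?_⟩
    · rintro e (he | he) g (hg | hg) v hve hvg
      · exact hK e he g hg v hve hvg
      · exact absurd hvg (hcross e he g hg v hve)
      · exact absurd hve (hcross g hg e he v hvg)
      · exact hK' e he g hg v hve hvg
    · intro e he heK
      rcases hS he with he1 | he2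
      · obtain ⟨g, hg, hh⟩ := hdom e ⟨he, he1⟩ fun h => heK (.inl h)
        exact ⟨g, .inl hg, hh⟩
      · obtain ⟨g, hg, hh⟩ := hdom' e ⟨he, he2⟩ fun h => heK (.inr h)
        exact ⟨g, .inr hg, hh⟩

end SimpleGraph

/-! ### König's edge-colouring theorem -/

open Finset in
/-- A natural number matrix all of whose row and column sums are `n` is covered by `n` permutation
matrices. -/
theorem Matrix.exists_perms_of_sum_eq {ι : Type*} [Fintype ι] [DecidableEq ι] (n : ℕ)
    (B : ι → ι → ℕ) (hrow : ∀ i, ∑ j, B i j = n) (hcol : ∀ j, ∑ i, B i j = n) :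
    ∃ σ : Fin n → Equiv.Perm ι, ∀ i j, B i j ≠ 0 → ∃ t, σ t i = j := by
  induction n generalizing B with
  | zero =>
    refine ⟨fun _ => 1, fun i j h => absurd ?_ h⟩
    exact Finset.sum_eq_zero_iff.1 (hrow i) j (mem_univ j)
  | succ n ih =>
    -- Hall's condition by double counting: the rows in `s` have total `#s * (n + 1)`, all of it in
    -- the columns of `N`, which hold `n + 1` each.
    have hall : ∀ s : Finset ι, #s ≤ #(s.biUnion fun i => {j | B i j ≠ 0}) := by
      intro s
      set N := s.biUnion fun i => ({j | B i j ≠ 0} : Finset ι) with hN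
      refine Nat.le_of_mul_le_mul_right (c := n + 1) ?_ n.succ_pos
      calc #s * (n + 1) = ∑ i ∈ s, ∑ j, B i j := by simp [hrow]
        _ = ∑ i ∈ s, ∑ j ∈ N, B i j := by
          refine sum_congr rfl fun i hi => (sum_subset (subset_univ _) fun j _ hj => ?_).symm
          by_contra h
          exact hj (mem_biUnion.2 ⟨i, hi, by simpa using h⟩)
        _ = ∑ j ∈ N, ∑ i ∈ s, B i j := sum_comm
        _ ≤ ∑ j ∈ N, ∑ i, B i j := by
          gcongr with j
          exact subset_univ _
        _ = #N * (n + 1) := by simp [hcol]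
    obtain ⟨f, hf, hfB⟩ := (all_card_le_biUnion_card_iff_exists_injective _).1 hall
    let τ : Equiv.Perm ι := .ofBijective f (Finite.injective_iff_bijective.1 hf)
    have hτ : ∀ i, B i (τ i) ≠ 0 := fun i => (Finset.mem_filter.1 (hfB i)).2
    let B' : ι → ι → ℕ := fun i j => B i j - if τ i = j then 1 else 0
    have hB' : ∀ i j, B i j = B' i j + if τ i = j then 1 else 0 := by
      intro i j
      simp only [B']
      split_ifs with h
      · subst h
        have := hτ i
        omega
      · simp
    obtain ⟨σ, hσ⟩ := ih B'
      (fun i => by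
        have := hrow i
        simp only [hB', sum_add_distrib, sum_ite_eq, mem_univ, if_true] at this
        omega)
      (fun j => by
        have := hcol j
        simp only [hB', sum_add_distrib, ← Equiv.eq_symm_apply, sum_ite_eq', mem_univ,
          if_true] at this
        omega)
    refine ⟨Fin.cons τ σ, fun i j h => ?_⟩
    by_cases hij : τ i = j
    · exact ⟨0, by simpa using hij⟩
    · obtain ⟨t, ht⟩ := hσ i j (by simpa [hB', hij] using h)
      exact ⟨t.succ, by simpa using ht⟩

namespace SimpleGraph

variable {V : Type*}

/-- `c` restricts to a proper edge-colouring of `G`. -/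
def IsProperEdgeColouring {α : Type*} (G : SimpleGraph V) (c : Sym2 V → α) : Prop :=
  ∀ ⦃u v w⦄, G.Adj u v → G.Adj u w → c s(u, v) = c s(u, w) → v = w

open Classical in
/-- König's edge-colouring theorem. -/
theorem exists_edgeSet_colouring_of_bipartite [Finite V] (G : SimpleGraph V) (D : Set V)
    (hD : ∀ u v, G.Adj u v → (u ∈ D ↔ v ∉ D)) (n : ℕ)
    (hdeg : ∀ v, (G.neighborSet v).ncard ≤ n) :
    ∃ c : G.edgeSet → Fin n, ∀ e f : G.edgeSet, ∀ v, v ∈ (e : Sym2 V) → v ∈ (f : Sym2 V) →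
      c e = c f → e = f := by
  have := Fintype.ofFinite V
  let H : V → V → ℕ := fun u v => if G.Adj u v ∧ u ∈ D then 1 else 0
  have hle : ∀ u (Q : V → Prop) [DecidablePred Q], (∀ v, Q v → G.Adj u v) →
      ∑ v, (if Q v then 1 else 0) ≤ n := by
    intro u Q _ hQ
    refine le_trans ?_ (hdeg u)
    rw [Set.ncard_eq_toFinset_card', Finset.sum_boole, Nat.cast_id]
    exact Finset.card_le_card fun v hv => by simpa using hQ v (by simpa using hv)
  have hr : ∀ u, ∑ v, H u v ≤ n := fun u => hle u (fun v => G.Adj u v ∧ u ∈ D) fun v h => h.1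
  have hc : ∀ v, ∑ u, H u v ≤ n := fun v => hle v (fun u => G.Adj u v ∧ u ∈ D) fun u h => h.1.symm
  -- The biadjacency matrix `H` is completed by its transpose and by two diagonal blocks of
  -- deficits, so that all row and column sums become `n`.
  let B : V ⊕ V → V ⊕ V → ℕ := fun i j =>
    match i, j with
    | .inl u, .inl v => H u v
    | .inl u, .inr v => if u = v then n - ∑ w, H u w else 0
    | .inr u, .inl v => if u = v then n - ∑ w, H w u else 0
    | .inr u, .inr v => H v u
  obtain ⟨σ, hσ⟩ := Matrix.exists_perms_of_sum_eq n B
    (by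
      rintro (u | u)
      · simp [B, hr u]
      · simp [B, hc u])
    (by
      rintro (u | u)
      · simp [B, hc u]
      · simp [B, hr u])
  have hex : ∀ e : G.edgeSet, ∃ t : Fin n, ∀ u v, (e : Sym2 V) = s(u, v) → u ∈ D →
      σ t (.inl u) = .inl v := by
    rintro ⟨e, he⟩
    induction e with
    | _ x y =>
      wlog hx : x ∈ D generalizing x y
      · have := this y x (G.adj_symm he) (by have := hD x y he; tauto)
        simpa only [Sym2.eq_swap] using this
      have hy : y ∉ D := (hD x y he).1 hx
      obtain ⟨t, ht⟩ := hσ (.inl x) (.inl y) (by simpa [B, H, hx] using he)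
      refine ⟨t, fun u v huv hu => ?_⟩
      rcases Sym2.eq_iff.1 huv with ⟨rfl, rfl⟩ | ⟨rfl, rfl⟩
      · exact ht
      · exact absurd hu hy
  choose c hc using hex
  have hend : ∀ e : G.edgeSet, ∃ u v, (e : Sym2 V) = s(u, v) ∧ u ∈ D ∧ v ∉ D := by
    rintro ⟨e, he⟩
    induction e with
    | _ x y =>
      have := hD x y he
      by_cases hx : x ∈ D
      · exact ⟨x, y, rfl, hx, this.1 hx⟩
      · exact ⟨y, x, Sym2.eq_swap, by tauto, hx⟩
  refine ⟨c, fun e f v hve hvf hcef => Subtype.ext ?_⟩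
  obtain ⟨u, w, he, hu, hw⟩ := hend e
  obtain ⟨u', w', hf, hu', hw'⟩ := hend f
  have h1 := hc e u w he hu
  have h2 := hc f u' w' hf hu'
  rw [hcef] at h1
  rw [he, Sym2.mem_iff] at hve
  rw [hf, Sym2.mem_iff] at hvf
  rw [he, hf]
  rcases hve with rfl | rfl <;> rcases hvf with rfl | rfl
  · rw [h1] at h2
    rw [Sum.inl_injective h2]
  · exact absurd hu hw'
  · exact absurd hu' hw
  · rw [Sum.inl_injective ((σ _).injective (h1.trans h2.symm))]

open Classical in
/-- König's edge-colouring theorem with a palette `P`, where moreover the colours at one vertex `r`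
can be required to belong to `A`. -/
theorem exists_edgeColouring_of_bipartite [Finite V] {α : Type*} [Nonempty α] [DecidableEq α] (G : SimpleGraph V)
    (D : Set V) (hD : ∀ u v, G.Adj u v → (u ∈ D ↔ v ∉ D)) (P : Finset α)
    (hdeg : ∀ v, (G.neighborSet v).ncard ≤ P.card) (r : V) (A : Finset α)
    (hA : (G.neighborSet r).ncard ≤ (A ∩ P).card) :
    ∃ c : Sym2 V → α, G.IsProperEdgeColouring c ∧ (∀ u v, G.Adj u v → c s(u, v) ∈ P) ∧
      ∀ v, G.Adj r v → c s(r, v) ∈ A := by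
  have := Fintype.ofFinite V
  obtain ⟨c, hc⟩ := G.exists_edgeSet_colouring_of_bipartite D hD P.card hdeg
  -- `C` is the set of colours used at `r`. It has at most `deg r` elements, so a permutation of the
  -- palette moves it into `A`.
  let C : Finset (Fin P.card) := {t | ∃ e : G.edgeSet, r ∈ (e : Sym2 V) ∧ c e = t}
  have hC : C.card ≤ (A ∩ P).card := by
    refine le_trans ?_ hA
    rw [Set.ncard_eq_toFinset_card']
    have : C ⊆ ((G.neighborSet r).toFinset.attach).image fun v : {v // v ∈ (G.neighborSet r).toFinset} =>
        c ⟨s(r, v.1), by rw [mem_edgeSet]; exact Set.mem_toFinset.1 v.2⟩ := by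
      intro t ht
      simp only [C, Finset.mem_filter, Finset.mem_univ, true_and] at ht
      obtain ⟨⟨e, he⟩, hre, rfl⟩ := ht
      obtain ⟨v, rfl⟩ := hre
      simp only [Finset.mem_image, Finset.mem_attach, true_and, Subtype.exists]
      exact ⟨v, by simpa using he, rfl⟩
    exact (Finset.card_le_card this).trans (Finset.card_image_le.trans (by simp))
  obtain ⟨A', hA', hcard⟩ := Finset.exists_subset_card_eq hC
  let g := P.equivFin
  let Q : Finset (Fin P.card) := A'.attach.image fun a : {a // a ∈ A'} =>
    g ⟨a.1, (Finset.mem_inter.1 (hA' a.2)).2⟩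
  have hQ : Q.card = C.card := by
    rw [Finset.card_image_of_injective, Finset.card_attach, hcard]
    intro a b h
    exact Subtype.ext (congrArg (fun x : {x // x ∈ P} => x.1) (g.injective h))
  have hQA : ∀ t ∈ Q, (g.symm t : α) ∈ A := by
    intro t ht
    obtain ⟨a, -, rfl⟩ := Finset.mem_image.1 ht
    simpa using (Finset.mem_inter.1 (hA' a.2)).1
  let ε : {t // t ∈ C} ≃ {t // t ∈ Q} := Finset.equivOfCardEq hQ.symm
  let π : Equiv.Perm (Fin P.card) := ε.extendSubtype
  have hπ : ∀ t ∈ C, π t ∈ Q := fun t ht => ε.extendSubtype_mem t ht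
  refine ⟨fun e => if h : e ∈ G.edgeSet then g.symm (π (c ⟨e, h⟩)) else Classical.arbitrary α,
    ?_, ?_, ?_⟩
  · intro u v w huv huw h
    beta_reduce at h
    rw [dif_pos (by simpa using huv), dif_pos (by simpa using huw)] at h
    have := hc _ _ u (by simp) (by simp) (π.injective (g.symm.injective (Subtype.ext h)))
    exact Sym2.congr_right.1 (Subtype.ext_iff.1 this)
  · intro u v huv
    beta_reduce
    rw [dif_pos (by simpa using huv)]
    exact Subtype.prop _
  · intro v hrv
    beta_reduce
    rw [dif_pos (by simpa using hrv)]
    refine hQA _ (hπ _ ?_)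
    simp only [C, Finset.mem_filter, Finset.mem_univ, true_and]
    exact ⟨_, by simp, rfl⟩

end SimpleGraph

/-! ### Structure of graphs whose odd cycles are triangles -/

namespace SimpleGraph

variable {V : Type*}

/-- Every odd cycle of `G` is a triangle: a path of even length whose ends are adjacent has length
at most `2`. -/
def OddCyclesAreTriangles (G : SimpleGraph V) : Prop :=
  ∀ ⦃u v : V⦄ (p : G.Walk u v), p.IsPath → G.Adj v u → Even p.length → p.length ≤ 2

theorem oddCyclesAreTriangles_of_isCycle {G : SimpleGraph V}
    (hG : ∀ (v : V) (c : G.Walk v v), c.IsCycle → Odd c.length → c.length < 5) :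
    G.OddCyclesAreTriangles := by
  intro u v p hp hvu heven
  by_contra! hlen
  have := hG v (.cons hvu p) ((Walk.cons_isCycle_iff p hvu).2 ⟨hp, fun hmem => ?_⟩)
    (by simpa using heven.add_one)
  · rw [Walk.length_cons] at this
    obtain ⟨m, hm⟩ := heven
    omega
  · rw [Sym2.eq_swap] at hmem
    have := hp.length_eq_one_of_mem_edges hmem
    omega

theorem OddCyclesAreTriangles.mono {G H : SimpleGraph V} (h : G.OddCyclesAreTriangles)
    (hHG : H ≤ G) : H.OddCyclesAreTriangles := by
  intro u v p hp hvu heven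
  simpa using h (p.mapLe hHG) (hp.mapLe hHG) (hHG hvu) (by simpa using heven)

-- Without triangles there are no odd cycles at all. Each loop cut out by `bypass` is a path closed
-- by an edge, hence of even length, so `bypass` preserves parity; it turns a closed walk into the
-- empty one.
open Classical in
theorem OddCyclesAreTriangles.colorable_two {G : SimpleGraph V} (h : G.OddCyclesAreTriangles)
    (htri : ∀ x y z, G.Adj x y → G.Adj y z → ¬ G.Adj x z) : G.Colorable 2 := by
  have hclose : ∀ {u v : V} (p : G.Walk u v), p.IsPath → G.Adj v u → ¬ Even p.length := by
    intro u v p hp hvu heven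
    have hle := h p hp hvu heven
    match p, hp, heven, hle with
    | .nil, _, _, _ => exact G.loopless.irrefl _ hvu
    | .cons h1 (.cons h2 .nil), _, _, _ => exact htri _ _ _ h1 h2 hvu.symm
    | .cons h1 .nil, _, heven, _ => simp at heven
    | .cons h1 (.cons h2 (.cons h3 p)), _, _, hle =>
      simp only [Walk.length_cons] at hle
      omega
  have hbyp : ∀ {u v : V} (p : G.Walk u v), Even p.length ↔ Even p.bypass.length := by
    intro u v p
    induction p with
    | nil => simp [Walk.bypass]
    | @cons u v w hadj p ih =>
      simp only [Walk.bypass]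
      split_ifs with hu
      · have hp := p.bypass_isPath.takeUntil hu
        have hlen := congrArg Walk.length (p.bypass.take_spec hu)
        rw [Walk.length_append] at hlen
        have hodd := hclose _ hp hadj
        rw [Walk.length_cons, Nat.even_add_one, ih, ← hlen, Nat.even_add]
        tauto
      · simp only [Walk.length_cons, Nat.even_add_one, ih]
  rw [two_colorable_iff_forall_loop_even]
  intro u p
  rw [hbyp p, (Walk.isPath_iff_nil.1 p.bypass_isPath).eq_nil]
  simp

/-- The graph formed by the edges of `G` that do not lie inside `W`. -/
def deleteInside (G : SimpleGraph V) (W : Set V) : SimpleGraph V where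
  Adj u v := G.Adj u v ∧ ¬ (u ∈ W ∧ v ∈ W)
  symm := ⟨fun _ _ h => ⟨h.1.symm, fun h' => h.2 h'.symm⟩⟩
  loopless := ⟨fun _ h => G.loopless.irrefl _ h.1⟩

theorem deleteInside_le (G : SimpleGraph V) (W : Set V) : G.deleteInside W ≤ G :=
  fun _ _ h => h.1

/-- `W` meets every component of the graph formed by the edges not inside `W` at most once. -/
def IsBlockSet (G : SimpleGraph V) (W : Set V) : Prop :=
  ∀ u ∈ W, ∀ v ∈ W, (G.deleteInside W).Reachable u v → u = v

-- A shortest walk between two vertices of `W` in the remaining graph has no interior vertex in `W`.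
-- It is not a single edge, since edges inside `W` are deleted.
open Classical in
theorem exists_path_of_not_isBlockSet {G : SimpleGraph V} {W : Set V} (h : ¬ G.IsBlockSet W) :
    ∃ (u v : V) (p : G.Walk u v), u ∈ W ∧ v ∈ W ∧ u ≠ v ∧ p.IsPath ∧ 2 ≤ p.length ∧
      ∀ x ∈ p.support, x ∈ W → x = u ∨ x = v := by
  have hex : ∃ n, ∃ (u v : V) (p : (G.deleteInside W).Walk u v), u ∈ W ∧ v ∈ W ∧ u ≠ v ∧
      p.length = n := by
    simp only [IsBlockSet] at h
    push Not at h
    obtain ⟨u, hu, v, hv, ⟨p⟩, huv⟩ := h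
    exact ⟨_, u, v, p, hu, hv, huv, rfl⟩
  obtain ⟨u, v, p, hu, hv, huv, hlen⟩ := Nat.find_spec hex
  have hmin : ∀ (u v : V) (q : (G.deleteInside W).Walk u v), u ∈ W → v ∈ W → u ≠ v →
      p.length ≤ q.length := fun u v q hu hv huv =>
    hlen ▸ Nat.find_min' hex ⟨u, v, q, hu, hv, huv, rfl⟩
  have hq := p.bypass_isPath
  have hql := p.length_bypass_le_length
  generalize p.bypass = q at hq hql
  refine ⟨u, v, q.mapLe (G.deleteInside_le W), hu, hv, huv, hq.mapLe _, ?_, fun x hx hxW => ?_⟩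
  · rw [Walk.length_mapLe]
    match q with
    | .nil => exact absurd rfl huv
    | .cons h .nil => exact absurd ⟨hu, hv⟩ h.2
    | .cons _ (.cons _ q) => simp
  · rw [Walk.support_mapLe_eq_support] at hx
    by_contra! hne
    have h1 := hmin u x (q.takeUntil x hx) hu hxW hne.1.symm
    have h2 := Walk.length_takeUntil_lt_length hx hne.2
    omega

namespace OddCyclesAreTriangles

variable {G : SimpleGraph V} {u v x y : V} {p : G.Walk u v}

/-- Closing a path through one outside vertex adds two to its length, through two outside vertices
three. The parity of the path decides which closure is an odd cycle, and that cycle must be a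
triangle. -/
theorem length_le_one (h : G.OddCyclesAreTriangles) (hp : p.IsPath) (hx : x ∉ p.support)
    (hvx : G.Adj v x) (hxu : G.Adj x u) (hodd : Odd p.length) : p.length ≤ 1 := by
  have := h (p.concat hvx) (hp.concat hx hvx) hxu (by simpa using hodd.add_one)
  simpa using this

theorem length_eq_zero (h : G.OddCyclesAreTriangles) (hp : p.IsPath) (hx : x ∉ p.support)
    (hy : y ∉ p.support) (hvx : G.Adj v x) (hxy : G.Adj x y) (hyu : G.Adj y u)
    (heven : Even p.length) : p.length = 0 := by
  have := h ((p.concat hvx).concat hxy) ((hp.concat hx hvx).concat (by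
    simpa [Walk.support_concat, hy] using hxy.ne') hxy) hyu
    (by simpa [add_assoc] using heven.add even_two)
  simpa using this

theorem length_eq_zero_or_one (h : G.OddCyclesAreTriangles) (hp : p.IsPath) (hx : x ∉ p.support)
    (hy : y ∉ p.support) (hvx : G.Adj v x) (hxy : G.Adj x y) (hxu : G.Adj x u) (hyu : G.Adj y u) :
    p.length ≤ 1 := by
  rcases Nat.even_or_odd p.length with he | ho
  · exact (h.length_eq_zero hp hx hy hvx hxy hyu he).le.trans zero_le_one
  · exact h.length_le_one hp hx hvx hxu ho

/-- For a path leaving the clique and returning, the two clique vertices it misses offer detours of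
both parities. -/
theorem isBlockSet_of_isNClique (h : G.OddCyclesAreTriangles) [DecidableEq V] {W : Finset V}
    (hW : G.IsNClique 4 W) : G.IsBlockSet W := by
  by_contra hcon
  obtain ⟨u, v, p, hu, hv, huv, hp, hlen, hin⟩ := exists_path_of_not_isBlockSet hcon
  have hcard : (W \ {u, v}).card = 2 := by
    have hsub : ({u, v} : Finset V) ⊆ W := by
      intro z hz
      simp only [Finset.mem_insert, Finset.mem_singleton] at hz
      rcases hz with rfl | rfl
      exacts [hu, hv]
    rw [Finset.card_sdiff_of_subset hsub, hW.card_eq, Finset.card_pair huv]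
  obtain ⟨x, y, hxy, hset⟩ := Finset.card_eq_two.1 hcard
  have hx : x ∈ W \ {u, v} := by simp [hset]
  have hy : y ∈ W \ {u, v} := by simp [hset]
  simp only [Finset.mem_sdiff, Finset.mem_insert, Finset.mem_singleton, not_or] at hx hy
  have hadj : ∀ a ∈ W, ∀ b ∈ W, a ≠ b → G.Adj a b := fun a ha b hb hab => hW.isClique ha hb hab
  have := h.length_eq_zero_or_one hp (x := x) (y := y)
    (fun hmem => by have := hin x hmem hx.1; tauto) (fun hmem => by have := hin y hmem hy.1; tauto)
    (hadj v hv x hx.1 (Ne.symm hx.2.2)) (hadj x hx.1 y hy.1 hxy) (hadj x hx.1 u hu hx.2.1)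
    (hadj y hy.1 u hu hy.2.1)
  omega

end OddCyclesAreTriangles

theorem Walk.exists_adj_adj_of_length_eq_two {G : SimpleGraph V} {u v : V} (p : G.Walk u v)
    (h : p.length = 2) : ∃ m ∈ p.support, G.Adj u m ∧ G.Adj m v := by
  match p, h with
  | .cons (v := m) h1 (.cons h2 .nil), _ => exact ⟨m, by simp, h1, h2⟩

/-- In a graph without `4`-cliques, whose odd cycles are triangles, an edge with the greatest number
of common neighbours spans a block together with these. -/
theorem OddCyclesAreTriangles.isBlockSet_of_commonNeighbors [Finite V] {G : SimpleGraph V}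
    (h : G.OddCyclesAreTriangles) {a b : V} (hab : G.Adj a b)
    (hne : (G.commonNeighbors a b).Nonempty)
    (hmax : ∀ x y, G.Adj x y → (G.commonNeighbors x y).ncard ≤ (G.commonNeighbors a b).ncard) :
    G.IsBlockSet (insert a (insert b (G.commonNeighbors a b))) := by
  set L := G.commonNeighbors a b with hL
  have hLa : ∀ l ∈ L, G.Adj a l := fun l hl => hl.1
  have hLb : ∀ l ∈ L, G.Adj b l := fun l hl => hl.2
  -- no long path joins the two hubs
  have hub : ∀ p : G.Walk a b, p.IsPath → 2 ≤ p.length →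
      ¬ ∀ x ∈ p.support, x ∈ insert a (insert b L) → x = a ∨ x = b := by
    intro p hp hlen hin
    obtain ⟨l, hl⟩ := hne
    have hlp : l ∉ p.support := fun hmem => by
      rcases hin l hmem (by simp [hl]) with rfl | rfl
      · exact (hLa l hl).ne rfl
      · exact (hLb l hl).ne rfl
    rcases Nat.even_or_odd p.length with he | ho
    -- The path has length two, so its middle vertex is a common neighbour of `a` and `b`, although
    -- its interior avoids the block.
    · obtain ⟨m, hm, h1, h2⟩ := p.exists_adj_adj_of_length_eq_two
        (le_antisymm (h p hp hab.symm he) hlen)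
      rcases hin m hm (.inr (.inr ⟨h1, h2.symm⟩)) with rfl | rfl
      · exact h1.ne rfl
      · exact h2.ne rfl
    · have := h.length_le_one hp hlp (hLb l hl) (hLa l hl).symm ho
      omega
  -- no long path joins a hub to a common neighbour
  have spoke : ∀ a' b', G.Adj a' b' → (∀ l ∈ L, G.Adj a' l ∧ G.Adj b' l) → ∀ l ∈ L,
      ∀ p : G.Walk a' l, p.IsPath → 2 ≤ p.length →
      ¬ ∀ x ∈ p.support, (x = b' ∨ x ∈ L) → x = a' ∨ x = l := by
    intro a' b' hab' hL' l hl p hp hlen hin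
    have hbp : b' ∉ p.support := fun hmem => by
      rcases hin b' hmem (.inl rfl) with rfl | rfl
      · exact hab'.ne rfl
      · exact (hL' _ hl).2.ne rfl
    rcases Nat.even_or_odd p.length with he | ho
    · obtain ⟨m, hm, h1, h2⟩ := p.exists_adj_adj_of_length_eq_two
        (le_antisymm (h p hp (hL' l hl).1.symm he) hlen)
      -- A second common neighbour `l'` gives the 5-cycle `a' m l b' l'`. If there is none, `b'` and
      -- `m` are two common neighbours of `a'` and `l`, against the maximality of `L`.
      by_cases hl' : ∃ l' ∈ L, l' ≠ l
      · obtain ⟨l', hl', hne'⟩ := hl'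
        have hlp : l' ∉ p.support := fun hmem => by
          rcases hin l' hmem (.inr hl') with rfl | rfl
          · exact (hL' l' hl').1.ne rfl
          · exact hne' rfl
        have := h.length_eq_zero hp hbp hlp (hL' l hl).2.symm (hL' l' hl').2 (hL' l' hl').1.symm he
        omega
      · push Not at hl'
        have hLl : L = {l} := Set.eq_singleton_iff_unique_mem.2 ⟨hl, hl'⟩
        have h3 : ({b', m} : Set V) ⊆ G.commonNeighbors a' l := by
          rintro z (rfl | rfl)
          · exact ⟨hab', (hL' l hl).2.symm⟩
          · exact ⟨h1, h2.symm⟩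
        have h4 := Set.ncard_le_ncard h3 (Set.toFinite _)
        rw [Set.ncard_pair (fun h : b' = m => hbp (h ▸ hm))] at h4
        have h5 := h4.trans (hmax a' l (hL' l hl).1)
        rw [hLl, Set.ncard_singleton] at h5
        omega
    · have := h.length_le_one hp hbp (hL' l hl).2.symm hab'.symm ho
      omega
  have hLab : ∀ l ∈ L, G.Adj a l ∧ G.Adj b l := fun l hl => hl
  have hLba : ∀ l ∈ L, G.Adj b l ∧ G.Adj a l := fun l hl => hl.symm
  by_contra hcon
  obtain ⟨u, v, p, hu, hv, huv, hp, hlen, hin⟩ := exists_path_of_not_isBlockSet hcon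
  have hp' := hp.reverse
  have hlen' : 2 ≤ p.reverse.length := by simpa using hlen
  have hin' : ∀ x ∈ p.reverse.support, x ∈ insert a (insert b L) → x = v ∨ x = u :=
    fun x hx hxW => (hin x (by simpa using hx) hxW).symm
  rcases hu with rfl | rfl | hu <;> rcases hv with rfl | rfl | hv
  · exact huv rfl
  · exact hub p hp hlen hin
  · exact spoke _ _ hab hLab _ hv p hp hlen fun x hx hxW => hin x hx (.inr hxW)
  · exact hub p.reverse hp' hlen' hin'
  · exact huv rfl
  · refine spoke _ _ hab.symm hLba _ hv p hp hlen fun x hx hxW => hin x hx ?_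
    rcases hxW with hxa | hxL
    exacts [.inl hxa, .inr (.inr hxL)]
  · exact spoke _ _ hab hLab _ hu p.reverse hp' hlen' fun x hx hxW => hin' x hx (.inr hxW)
  · refine spoke _ _ hab.symm hLba _ hu p.reverse hp' hlen' fun x hx hxW => hin' x hx ?_
    rcases hxW with hxa | hxL
    exacts [.inl hxa, .inr (.inr hxL)]
  -- Between two common neighbours, the hubs `a` and `b` offer detours of both parities.
  · have ha : a ∉ p.support := fun hmem => by
      rcases hin a hmem (.inl rfl) with rfl | rfl
      · exact (hLa _ hu).ne rfl
      · exact (hLa _ hv).ne rfl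
    have hb : b ∉ p.support := fun hmem => by
      rcases hin b hmem (.inr (.inl rfl)) with rfl | rfl
      · exact (hLb _ hu).ne rfl
      · exact (hLb _ hv).ne rfl
    have := h.length_eq_zero_or_one hp ha hb (hLa v hv).symm hab (hLa u hu) (hLb u hu)
    omega

/-- `G` is the union of two graphs with at least one edge each and at most the vertex `v` in
common. -/
def IsSeparation (G G₁ G₂ : SimpleGraph V) (v : V) : Prop :=
  G₁ ⊔ G₂ = G ∧ G₁ ≠ ⊥ ∧ G₂ ≠ ⊥ ∧ ∀ x y z, G₁.Adj x y → G₂.Adj x z → x = v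

/-- Split off the component of `xy` among the edges not inside `W`. A vertex meeting both parts must
lie in `W`, since otherwise all its edges belong to that component, and the component contains at
most one vertex of `W`. -/
theorem IsBlockSet.exists_isSeparation {G : SimpleGraph V} {W : Set V} (hW : G.IsBlockSet W)
    {a b : V} (haW : a ∈ W) (hbW : b ∈ W) (hab : G.Adj a b)
    {x y : V} (hxy : G.Adj x y) (hxyW : ¬ (x ∈ W ∧ y ∈ W)) :
    ∃ G₁ G₂ v, G.IsSeparation G₁ G₂ v := by
  classical
  let X := G.deleteInside W
  have hX : X.Adj x y := ⟨hxy, hxyW⟩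
  let G₂ : SimpleGraph V :=
    { Adj := fun u w => X.Adj u w ∧ X.Reachable x u
      symm := ⟨fun u w h => ⟨h.1.symm, h.2.trans h.1.reachable⟩⟩
      loopless := ⟨fun _ h => X.loopless.irrefl _ h.1⟩ }
  let G₁ : SimpleGraph V :=
    { Adj := fun u w => G.Adj u w ∧ ¬ (X.Adj u w ∧ X.Reachable x u)
      symm := ⟨fun u w h => ⟨h.1.symm, fun h' => h.2 ⟨h'.1.symm, h'.2.trans h'.1.reachable⟩⟩⟩
      loopless := ⟨fun _ h => G.loopless.irrefl _ h.1⟩ }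
  have hcut : ∃ v, ∀ w ∈ W, X.Reachable x w → w = v := by
    by_cases h : ∃ v ∈ W, X.Reachable x v
    · obtain ⟨v, hv, hxv⟩ := h
      exact ⟨v, fun w hw hxw => hW w hw v hv (hxw.symm.trans hxv)⟩
    · push Not at h
      -- The component misses `W`, so the parts share no vertex and any choice of `v` will do.
      exact ⟨x, fun w hw hxw => absurd hxw (h w hw)⟩
  obtain ⟨v, hv⟩ := hcut
  refine ⟨G₁, G₂, v, ?_, ?_, ?_, ?_⟩
  · ext u w
    simp only [sup_adj, G₁, G₂]
    refine ⟨?_, fun h => ?_⟩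
    · rintro (h | h)
      exacts [h.1, h.1.1]
    · by_cases h' : X.Adj u w ∧ X.Reachable x u
      exacts [.inr h', .inl ⟨h, h'⟩]
  · intro hbot
    have : G₁.Adj a b := ⟨hab, fun h => h.1.2 ⟨haW, hbW⟩⟩
    simp [hbot] at this
  · intro hbot
    have : G₂.Adj x y := ⟨hX, .refl _⟩
    simp [hbot] at this
  · intro u w z h1 h2
    have huW : u ∈ W := by
      by_contra hu
      exact h1.2 ⟨⟨h1.1, fun h => hu h.1⟩, h2.2⟩
    exact hv u huW h2.2

/-- The edges of `G` are those of a `4`-clique. -/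
def IsFourClique (G : SimpleGraph V) (W : Finset V) : Prop :=
  G.IsNClique 4 W ∧ ∀ u v, G.Adj u v → u ∈ W ∧ v ∈ W

/-- `G` consists of at least one triangle on a common edge `ab`. -/
def IsTriangleBook (G : SimpleGraph V) (a b : V) (L : Set V) : Prop :=
  G.Adj a b ∧ L.Nonempty ∧ (∀ l ∈ L, G.Adj a l ∧ G.Adj b l) ∧
    ∀ u v, G.Adj u v → (u = a ∨ u = b) ∧ (v = a ∨ v = b) ∨ (u = a ∨ u = b) ∧ v ∈ L ∨
      u ∈ L ∧ (v = a ∨ v = b)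

theorem OddCyclesAreTriangles.structure [Finite V] {G : SimpleGraph V}
    (h : G.OddCyclesAreTriangles) :
    G.Colorable 2 ∨ (∃ W, G.IsFourClique W) ∨ (∃ a b L, G.IsTriangleBook a b L) ∨
      ∃ G₁ G₂ v, G.IsSeparation G₁ G₂ v := by
  classical
  by_cases htri : ∀ x y z, G.Adj x y → G.Adj y z → ¬ G.Adj x z
  · exact .inl (h.colorable_two htri)
  push Not at htri
  obtain ⟨x, y, z, hxy, hyz, hxz⟩ := htri
  right
  by_cases h4 : ∃ W, G.IsNClique 4 W
  · obtain ⟨W, hW⟩ := h4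
    by_cases hall : ∀ u v, G.Adj u v → u ∈ W ∧ v ∈ W
    · exact .inl ⟨W, hW, hall⟩
    · push Not at hall
      obtain ⟨u, v, huv, huvW⟩ := hall
      obtain ⟨a, ha, b, hb, hab⟩ := Finset.one_lt_card.1 (by rw [hW.card_eq]; norm_num)
      exact .inr (.inr ((h.isBlockSet_of_isNClique hW).exists_isSeparation ha hb
        (hW.isClique ha hb hab) huv (by simpa using huvW)))
  · have : Nonempty V := ⟨x⟩
    obtain ⟨⟨a, b⟩, hab, hmax⟩ := Set.exists_max_image {e : V × V | G.Adj e.1 e.2}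
      (fun e => (G.commonNeighbors e.1 e.2).ncard) (Set.toFinite _) ⟨(x, y), hxy⟩
    have hne : (G.commonNeighbors a b).Nonempty := by
      rw [← Set.ncard_pos (Set.toFinite _)]
      refine lt_of_lt_of_le ?_ (hmax (x, y) hxy)
      rw [Set.ncard_pos (Set.toFinite _)]
      exact ⟨z, hxz, hyz⟩
    have hblock := h.isBlockSet_of_commonNeighbors hab hne fun x y hxy => hmax (x, y) hxy
    by_cases hall : ∀ u v, G.Adj u v → u ∈ insert a (insert b (G.commonNeighbors a b)) ∧
        v ∈ insert a (insert b (G.commonNeighbors a b))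
    · refine .inr (.inl ⟨a, b, G.commonNeighbors a b, hab, hne, fun l hl => hl, fun u v huv => ?_⟩)
      obtain ⟨hu, hv⟩ := hall u v huv
      by_cases hLL : u ∈ G.commonNeighbors a b ∧ v ∈ G.commonNeighbors a b
      -- An edge between two common neighbours of `a` and `b` would complete a 4-clique.
      · refine absurd ⟨{a, b, u, v}, ?_⟩ h4
        refine (is3Clique_triple_iff.2 ⟨hLL.1.2, hLL.2.2, huv⟩).insert fun w hw => ?_
        simp only [Finset.mem_insert, Finset.mem_singleton] at hw
        rcases hw with rfl | rfl | rfl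
        exacts [hab, hLL.1.1, hLL.2.1]
      · simp only [Set.mem_insert_iff] at hu hv
        tauto
    · push Not at hall
      obtain ⟨u, v, huv, huvW⟩ := hall
      exact .inr (.inr (hblock.exists_isSeparation (.inl rfl) (.inr (.inl rfl)) hab huv
        (by tauto)))

end SimpleGraph

/-! ### Galvin colourings and their gluing -/

namespace SimpleGraph

variable {V : Type*} {d : ℕ}

open Classical in
/-- The rank of the edge `e` in the preferences of `v` that belong to the Galvin orientation with
respect to `Dᶜ`, `D` and `c`. -/
noncomputable def galvinRank (D : Set V) (c : Sym2 V → Fin (d + 1)) (v : V) (e : Sym2 V) : ℕ :=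
  if v ∈ D then c e else d - c e

theorem galvinRank_lt_iff {D : Set V} {c : Sym2 V → Fin (d + 1)} {v : V} {e f : Sym2 V} :
    galvinRank D c v f < galvinRank D c v e ↔ v ∈ D ∧ c f < c e ∨ v ∉ D ∧ c e < c f := by
  have he := (c e).is_le
  have hf := (c f).is_le
  by_cases hv : v ∈ D <;> simp only [galvinRank, hv, if_true, if_false, Fin.lt_def] <;> grind

theorem eq_of_galvinRank_eq {D : Set V} {c : Sym2 V → Fin (d + 1)} {v : V} {e f : Sym2 V}
    (h : galvinRank D c v e = galvinRank D c v f) : c e = c f := by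
  have he := (c e).is_le
  have hf := (c f).is_le
  rw [Fin.ext_iff]
  by_cases hv : v ∈ D <;> simp only [galvinRank, hv, if_true, if_false] at h <;> omega

/-- A colouring for which edges inside `D` have small colours, edges inside `Dᶜ` have large ones,
and whose Galvin orientation is kernel-perfect. -/
structure IsGalvinColouring (G : SimpleGraph V) (D : Set V) (c : Sym2 V → Fin (d + 1)) :
    Prop where
  proper : G.IsProperEdgeColouring c
  low : ∀ ⦃u v⦄, G.Adj u v → u ∈ D → v ∈ D → 2 * (c s(u, v) : ℕ) ≤ d
  high : ∀ ⦃u v⦄, G.Adj u v → u ∉ D → v ∉ D → d ≤ 2 * (c s(u, v) : ℕ)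
  perfect : StablyPerfect (galvinRank D c) G.edgeSet

theorem StablyPerfect.congr {ρ ρ' : V → Sym2 V → ℕ} {E : Set (Sym2 V)} (h : StablyPerfect ρ E)
    (hρ : ∀ e ∈ E, ∀ v ∈ e, ρ v e = ρ' v e) : StablyPerfect ρ' E := by
  intro S hS
  obtain ⟨K, hKS, hK, hdom⟩ := h S hS
  refine ⟨K, hKS, hK, fun e he heK => ?_⟩
  obtain ⟨f, hf, v, hve, hvf, hlt⟩ := hdom e he heK
  exact ⟨f, hf, v, hve, hvf, by rwa [← hρ e (hS he) v hve, ← hρ f (hS (hKS hf)) v hvf]⟩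

theorem IsGalvinColouring.congr {G : SimpleGraph V} {D D' : Set V} {c c' : Sym2 V → Fin (d + 1)}
    (h : G.IsGalvinColouring D c) (hD : ∀ u v, G.Adj u v → (u ∈ D ↔ u ∈ D'))
    (hc : ∀ u v, G.Adj u v → c s(u, v) = c' s(u, v)) : G.IsGalvinColouring D' c' where
  proper u v w huv huw h' := h.proper huv huw (by rw [hc u v huv, hc u w huw, h'])
  low u v huv hu hv := by
    rw [← hc u v huv]
    exact h.low huv ((hD u v huv).2 hu) ((hD v u huv.symm).2 hv)
  high u v huv hu hv := by
    rw [← hc u v huv]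
    exact h.high huv (mt (hD u v huv).1 hu) (mt (hD v u huv.symm).1 hv)
  perfect := h.perfect.congr fun e he v hv => by
    obtain ⟨w, rfl⟩ := hv
    have hvD := hD v w he
    by_cases hv : v ∈ D
    · simp only [galvinRank, hv, hvD.1 hv, if_true, hc v w he]
    · simp only [galvinRank, hv, mt hvD.2 hv, if_false, hc v w he]

/-- Reversing the colours and exchanging the two sides leaves every rank unchanged. This makes the
side of the root a free choice, so the two pieces of a separation can be made to agree at the cut
vertex. -/
theorem IsGalvinColouring.compl_rev {G : SimpleGraph V} {D : Set V} {c : Sym2 V → Fin (d + 1)}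
    (h : G.IsGalvinColouring D c) : G.IsGalvinColouring Dᶜ (fun e => (c e).rev) where
  proper u v w huv huw h' := h.proper huv huw (Fin.rev_injective h')
  low u v huv hu hv := by
    have := h.high huv hu hv
    rw [Fin.val_rev]
    omega
  high u v huv hu hv := by
    have := h.low huv (not_not.1 hu) (not_not.1 hv)
    rw [Fin.val_rev]
    omega
  perfect := h.perfect.congr fun e he v hv => by
    have := (c e).is_le
    by_cases hvD : v ∈ D <;>
      simp only [galvinRank, hvD, Set.mem_compl_iff, not_true, not_false_iff, if_true, if_false,
        Fin.val_rev] <;> omega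

/-- For every vertex `r` and every set `A` of more than `deg r` colours, there is a Galvin colouring
with `r ∈ D` that uses only colours from `A` at `r`. -/
def RootedGalvinColourable (G : SimpleGraph V) (d : ℕ) : Prop :=
  ∀ (r : V) (A : Finset (Fin (d + 1))), (G.neighborSet r).ncard < A.card →
    ∃ (D : Set V) (c : Sym2 V → Fin (d + 1)), r ∈ D ∧ G.IsGalvinColouring D c ∧
      ∀ v, G.Adj r v → c s(r, v) ∈ A

theorem RootedGalvinColourable.exists_mem_iff {G : SimpleGraph V}
    (h : G.RootedGalvinColourable d) (r : V) (A : Finset (Fin (d + 1)))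
    (hA : (G.neighborSet r).ncard < A.card) (p : Prop) :
    ∃ (D : Set V) (c : Sym2 V → Fin (d + 1)), (r ∈ D ↔ p) ∧ G.IsGalvinColouring D c ∧
      ∀ v, G.Adj r v → c s(r, v) ∈ A := by
  by_cases hp : p
  · obtain ⟨D, c, hr, hc, hcA⟩ := h r A hA
    exact ⟨D, c, by tauto, hc, hcA⟩
  · obtain ⟨D, c, hr, hc, hcA⟩ := h r (A.map Fin.revPerm.toEmbedding) (by simpa using hA)
    refine ⟨Dᶜ, _, by simp [hr, hp], hc.compl_rev, fun v hv => ?_⟩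
    obtain ⟨a, ha, hac⟩ := Finset.mem_map.1 (hcA v hv)
    rw [← hac]
    simpa using ha

theorem IsSeparation.symm {G G₁ G₂ : SimpleGraph V} {v : V} (h : G.IsSeparation G₁ G₂ v) :
    G.IsSeparation G₂ G₁ v :=
  ⟨by rw [sup_comm, h.1], h.2.2.1, h.2.1, fun x y z h1 h2 => h.2.2.2 x z y h2 h1⟩

theorem IsSeparation.not_adj {G G₁ G₂ : SimpleGraph V} {v x y : V} (h : G.IsSeparation G₁ G₂ v)
    (h₁ : G₁.Adj x y) : ¬ G₂.Adj x y := fun h₂ =>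
  h₁.ne ((h.2.2.2 x y y h₁ h₂).trans (h.2.2.2 y x x h₁.symm h₂.symm).symm)

theorem IsGalvinColouring.sup [Finite V] {G G₁ G₂ : SimpleGraph V} {v : V} {D : Set V}
    {c : Sym2 V → Fin (d + 1)} (hsep : G.IsSeparation G₁ G₂ v) (h₁ : G₁.IsGalvinColouring D c)
    (h₂ : G₂.IsGalvinColouring D c)
    (hv : ∀ x y, G₁.Adj v x → G₂.Adj v y → c s(v, x) ≠ c s(v, y)) : G.IsGalvinColouring D c := by
  obtain ⟨rfl, -, -, hcut⟩ := hsep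
  have hproper : (G₁ ⊔ G₂).IsProperEdgeColouring c := by
    rintro u x y (hx | hx) (hy | hy) h
    · exact h₁.proper hx hy h
    · obtain rfl := hcut u x y hx hy
      exact absurd h (hv x y hx hy)
    · obtain rfl := hcut u y x hy hx
      exact absurd h.symm (hv y x hy hx)
    · exact h₂.proper hx hy h
  refine ⟨hproper, ?_, ?_, ?_⟩
  · rintro u w (h | h)
    exacts [h₁.low h, h₂.low h]
  · rintro u w (h | h)
    exacts [h₁.high h, h₂.high h]
  · rw [edgeSet_sup]
    refine h₁.perfect.union (r := v) h₂.perfect ?_ ?_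
    · rintro e he f hf u ⟨x, rfl⟩ ⟨y, rfl⟩
      exact hcut u x y he hf
    · rintro e he f hf ⟨x, rfl⟩ ⟨y, rfl⟩ h
      rw [← edgeSet_sup] at he hf
      exact congrArg _ (hproper he hf (eq_of_galvinRank_eq h))

theorem IsSeparation.ncard_neighborSet [Finite V] {G G₁ G₂ : SimpleGraph V} {v : V}
    (h : G.IsSeparation G₁ G₂ v) (u : V) :
    (G.neighborSet u).ncard = (G₁.neighborSet u).ncard + (G₂.neighborSet u).ncard := by
  rw [← Set.ncard_union_eq ?_ (Set.toFinite _) (Set.toFinite _), ← h.1]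
  · rfl
  · rw [Set.disjoint_left]
    exact fun x h1 h2 => h.not_adj h1 h2

theorem IsSeparation.rootedGalvinColourable [Finite V] {G G₁ G₂ : SimpleGraph V} {v : V}
    (hsep : G.IsSeparation G₁ G₂ v) (hdeg : ∀ u, (G.neighborSet u).ncard ≤ d)
    (h₁ : G₁.RootedGalvinColourable d) (h₂ : G₂.RootedGalvinColourable d) :
    G.RootedGalvinColourable d := by
  classical
  have := Fintype.ofFinite V
  intro r A hA
  -- Only the cut vertex has edges in both pieces, so the root can be assumed to belong to the
  -- first.
  wlog hr : r ≠ v → ∀ x, ¬ G₂.Adj r x generalizing G₁ G₂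
  · refine this hsep.symm h₂ h₁ fun hrv x hx => hr fun _ y hy => hrv (hsep.2.2.2 r x y hx hy)
  have hsum := hsep.ncard_neighborSet
  obtain ⟨D₁, c₁, hrD₁, hc₁, hcA₁⟩ := h₁ r A (by have := hsum r; omega)
  let used : Finset (Fin (d + 1)) := (G₁.neighborSet v).toFinset.image fun x => c₁ s(v, x)
  have hused : used.card ≤ (G₁.neighborSet v).ncard := by
    rw [Set.ncard_eq_toFinset_card']
    exact Finset.card_image_le
  -- The colours allowed at `v`: the prescribed ones if `v` is the root, otherwise all `d + 1`.
  -- Either way they outnumber `deg v`, so deleting those used in `G₁` leaves more than the degree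
  -- of `v` in `G₂`.
  let A' : Finset (Fin (d + 1)) := if r = v then A else Finset.univ
  have hA' : (G.neighborSet v).ncard < A'.card := by
    by_cases hrv : r = v
    · simpa only [A', hrv, if_true] using hrv ▸ hA
    · simpa only [A', hrv, if_false, Finset.card_univ, Fintype.card_fin] using
        Nat.lt_succ_of_le (hdeg v)
  obtain ⟨D₂, c₂, hvD, hc₂, hcA₂⟩ := h₂.exists_mem_iff v (A' \ used) (by
    have := Finset.le_card_sdiff used A'
    have := hsum v
    omega) (v ∈ D₁)
  let D : Set V := {w | if ∃ x, G₂.Adj w x then w ∈ D₂ else w ∈ D₁}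
  let c : Sym2 V → Fin (d + 1) := fun e => if e ∈ G₂.edgeSet then c₂ e else c₁ e
  have hcc₁ : ∀ u w, G₁.Adj u w → c₁ s(u, w) = c s(u, w) := fun u w h => by
    have : s(u, w) ∉ G₂.edgeSet := hsep.not_adj h
    simp [c, this]
  have hcc₂ : ∀ u w, G₂.Adj u w → c₂ s(u, w) = c s(u, w) := fun u w h => by
    have : s(u, w) ∈ G₂.edgeSet := h
    simp [c, this]
  have hDv : v ∈ D ↔ v ∈ D₁ := by
    simp only [D, Set.mem_ofPred_eq]
    split_ifs
    exacts [hvD, Iff.rfl]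
  refine ⟨D, c, ?_, .sup hsep (hc₁.congr (fun u w h => ?_) hcc₁)
    (hc₂.congr (fun u w h => ?_) hcc₂) ?_, ?_⟩
  · by_cases hrv : r = v
    · subst hrv
      exact hDv.2 hrD₁
    · have := hr hrv
      simp [D, this, hrD₁]
  · by_cases h2 : ∃ x, G₂.Adj u x
    · obtain ⟨x, hx⟩ := h2
      obtain rfl := hsep.2.2.2 u w x h hx
      exact hDv.symm
    · simp [D, h2]
  · have : ∃ x, G₂.Adj u x := ⟨w, h⟩
    simp [D, this]
  · intro x y hx hy h
    rw [← hcc₁ v x hx, ← hcc₂ v y hy] at h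
    refine (Finset.mem_sdiff.1 (hcA₂ y hy)).2 (h ▸ ?_)
    exact Finset.mem_image.2 ⟨x, by simpa using hx, rfl⟩
  · intro x hx
    rw [← hsep.1] at hx
    rcases hx with hx | hx
    · rw [← hcc₁ r x hx]
      exact hcA₁ x hx
    · have hrv : r = v := by
        by_contra hrv
        exact hr hrv x hx
      subst hrv
      rw [← hcc₂ r x hx]
      simpa [A'] using (Finset.mem_sdiff.1 (hcA₂ x hx)).1

end SimpleGraph

/-! ### Colourings of the unsplittable pieces -/

namespace SimpleGraph

variable {V : Type*} {d : ℕ}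

/-- The edges within the two sides form a matching. Coloured `lo` inside `D` and `hi` outside,
beyond the palette `P` of the crossing edges, they are best at both ends. In any edge set they are
taken first, and what remains is bipartite. -/
theorem exists_isGalvinColouring_of_sinks [Finite V] {G : SimpleGraph V} (D : Set V)
    (hmatch : ∀ u v w, G.Adj u v → G.Adj u w → (u ∈ D ↔ v ∈ D) → (u ∈ D ↔ w ∈ D) → v = w)
    (lo hi : Fin (d + 1)) (hlo : 2 * (lo : ℕ) ≤ d) (hhi : d ≤ 2 * (hi : ℕ))
    (P : Finset (Fin (d + 1)))
    (hloP : ∀ u v, G.Adj u v → u ∈ D → v ∈ D → ∀ p ∈ P, lo < p)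
    (hhiP : ∀ u v, G.Adj u v → u ∉ D → v ∉ D → ∀ p ∈ P, p < hi)
    (hdeg : ∀ u, {v | G.Adj u v ∧ (u ∈ D ↔ v ∉ D)}.ncard ≤ P.card)
    (r : V) (A : Finset (Fin (d + 1))) (hr : r ∈ D)
    (hA : {v | G.Adj r v ∧ (r ∈ D ↔ v ∉ D)}.ncard ≤ (A ∩ P).card)
    (hloA : ∀ v, G.Adj r v → v ∈ D → lo ∈ A) :
    ∃ c : Sym2 V → Fin (d + 1), G.IsGalvinColouring D c ∧ ∀ v, G.Adj r v → c s(r, v) ∈ A := by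
  classical
  let H : SimpleGraph V :=
    { Adj := fun u v => G.Adj u v ∧ (u ∈ D ↔ v ∉ D)
      symm := ⟨fun u v h => ⟨h.1.symm, by tauto⟩⟩
      loopless := ⟨fun _ h => G.loopless.irrefl _ h.1⟩ }
  obtain ⟨c₀, hc₀, hcP, hcA⟩ := H.exists_edgeColouring_of_bipartite D (fun u v h => h.2) P hdeg r A hA
  let c : Sym2 V → Fin (d + 1) := fun e =>
    if e ∈ H.edgeSet then c₀ e else if ∃ u ∈ e, u ∈ D then lo else hi
  have hcH : ∀ u v, H.Adj u v → c s(u, v) = c₀ s(u, v) := fun u v h => by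
    have : s(u, v) ∈ H.edgeSet := h
    simp [c, this]
  have hcHP : ∀ u v, H.Adj u v → c s(u, v) ∈ P := fun u v h => hcH u v h ▸ hcP u v h
  have hclo : ∀ u v, u ∈ D → v ∈ D → c s(u, v) = lo := fun u v hu hv => by
    have : s(u, v) ∉ H.edgeSet := fun h => h.2.1 hu hv
    simp [c, this, hu]
  have hchi : ∀ u v, u ∉ D → v ∉ D → c s(u, v) = hi := fun u v hu hv => by
    have : s(u, v) ∉ H.edgeSet := fun h => hu (h.2.2 hv)
    simp [c, this, hu, hv]
  have hmono : ∀ u v w, G.Adj u v → (u ∈ D ↔ v ∈ D) → G.Adj u w → v ≠ w →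
      u ∈ D ∧ c s(u, v) < c s(u, w) ∨ u ∉ D ∧ c s(u, w) < c s(u, v) := by
    intro u v w huv hD huw hne
    have hw : ¬ (u ∈ D ↔ w ∈ D) := fun h => hne (hmatch u v w huv huw hD h)
    have hP := hcHP u w ⟨huw, by tauto⟩
    by_cases hu : u ∈ D
    · refine .inl ⟨hu, ?_⟩
      rw [hclo u v hu (hD.1 hu)]
      exact hloP u v huv hu (hD.1 hu) _ hP
    · refine .inr ⟨hu, ?_⟩
      rw [hchi u v hu (mt hD.2 hu)]
      exact hhiP u v huv hu (mt hD.2 hu) _ hP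
  have hproper : G.IsProperEdgeColouring c := by
    intro u v w huv huw h
    by_contra hne
    by_cases hv : u ∈ D ↔ v ∈ D
    · rcases hmono u v w huv hv huw hne with h' | h'
      exacts [h'.2.ne h, h'.2.ne' h]
    by_cases hw : u ∈ D ↔ w ∈ D
    · rcases hmono u w v huw hw huv (Ne.symm hne) with h' | h'
      exacts [h'.2.ne' h, h'.2.ne h]
    have hv' : H.Adj u v := ⟨huv, by tauto⟩
    have hw' : H.Adj u w := ⟨huw, by tauto⟩
    rw [hcH u v hv', hcH u w hw'] at h
    exact hne (hc₀ hv' hw' h)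
  refine ⟨c, ⟨hproper, fun u v _ hu hv => ?_, fun u v _ hu hv => ?_, fun S hS => ?_⟩, fun v hv => ?_⟩
  · rwa [hclo u v hu hv]
  · rwa [hchi u v hu hv]
  · let M : Set (Sym2 V) := {e ∈ S | ∃ u v, e = s(u, v) ∧ (u ∈ D ↔ v ∈ D)}
    have hM : ∀ m ∈ M, ∀ v ∈ m, ∃ w, m = s(v, w) ∧ G.Adj v w ∧ (v ∈ D ↔ w ∈ D) := by
      rintro m ⟨hmS, x, y, rfl, hxy⟩ v hv
      have hadj : G.Adj x y := hS hmS
      rcases Sym2.mem_iff.1 hv with rfl | rfl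
      · exact ⟨y, rfl, hadj, hxy⟩
      · exact ⟨x, Sym2.eq_swap, hadj.symm, hxy.symm⟩
    refine .of_sinks (M := M) (fun e he => he.1) ?_ ?_ ?_
    · intro e he f hf v hve hvf
      obtain ⟨x, rfl, hx, hxD⟩ := hM e he v hve
      obtain ⟨y, rfl, hy, hyD⟩ := hM f hf v hvf
      rw [hmatch v x y hx hy hxD hyD]
    · intro m hm e he hne v hvm hve
      obtain ⟨x, rfl, hx, hxD⟩ := hM m hm v hvm
      obtain ⟨y, rfl⟩ := hve
      exact galvinRank_lt_iff.2 (hmono v x y hx hxD (hS he) fun h => hne (by rw [h]))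
    · refine hasStableMatching_of_bipartite D _ ?_ ?_
      · rintro e ⟨he, heM⟩
        induction e with
        | _ x y =>
          have hxy : ¬ (x ∈ D ↔ y ∈ D) := fun h =>
            heM _ ⟨he, x, y, rfl, h⟩ x (Sym2.mem_mk_left x y) (Sym2.mem_mk_left x y)
          by_cases hx : x ∈ D
          · exact ⟨x, y, rfl, hx, by tauto⟩
          · exact ⟨y, x, Sym2.eq_swap, by tauto, hx⟩
      · rintro e ⟨he, -⟩ f ⟨hf, -⟩ v ⟨x, rfl⟩ ⟨y, rfl⟩ h
        exact congrArg _ (hproper (hS he) (hS hf) (eq_of_galvinRank_eq h))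
  · by_cases hvD : v ∈ D
    · rw [hclo r v hr hvD]
      exact hloA v hv hvD
    · have : H.Adj r v := ⟨hv, by tauto⟩
      rw [hcH r v this]
      exact hcA v this

/-- The case of an independent set `D` outside of which the edges form a matching. -/
theorem exists_isGalvinColouring_of_indep [Finite V] {G : SimpleGraph V} (D : Set V)
    (hD : ∀ u v, G.Adj u v → u ∈ D → v ∉ D)
    (hmatch : ∀ u v w, G.Adj u v → G.Adj u w → u ∉ D → v ∉ D → w ∉ D → v = w)
    (hdeg : ∀ u, (G.neighborSet u).ncard ≤ d) (r : V) (hr : r ∈ D) (A : Finset (Fin (d + 1)))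
    (hA : (G.neighborSet r).ncard < A.card) :
    ∃ c : Sym2 V → Fin (d + 1), G.IsGalvinColouring D c ∧ ∀ v, G.Adj r v → c s(r, v) ∈ A := by
  have hle : ∀ u, {v | G.Adj u v ∧ (u ∈ D ↔ v ∉ D)}.ncard ≤ (G.neighborSet u).ncard := fun u =>
    Set.ncard_le_ncard (fun v hv => hv.1) (Set.toFinite _)
  -- Colour `d` is reserved for the matching outside `D`; `lo` is never used. Removing `d` from `A`
  -- still leaves at least `deg r` colours.
  refine exists_isGalvinColouring_of_sinks D (fun u v w huv huw hv hw => ?_) 0 (Fin.last d)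
    (by simp) (by simp; omega) (Finset.univ.erase (Fin.last d))
    (fun u v huv hu hv => absurd hv (hD u v huv hu)) (fun _ _ _ _ _ p hp => ?_) (fun u => ?_) r A hr
    ?_ (fun v hv hvD => absurd hvD (hD r v hv hr))
  · have := hD u v huv
    exact hmatch u v w huv huw (by tauto) (by tauto) (by tauto)
  · exact Fin.lt_last_iff_ne_last.2 (Finset.ne_of_mem_erase hp)
  · simpa using (hle u).trans (hdeg u)
  · rw [Finset.inter_erase, Finset.inter_univ]
    have := Finset.pred_card_le_card_erase (s := A) (a := Fin.last d)
    have := hle r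
    omega

/-- A `4`-clique or a book of at least two triangles seen from one end `r` of a central edge `rh`. -/
structure IsHub (G : SimpleGraph V) (r h : V) (L : Set V) : Prop where
  ne : r ≠ h
  root_notMem : r ∉ L
  hub_notMem : h ∉ L
  two_le : 2 ≤ L.ncard
  adj : ∀ ⦃u v⦄, G.Adj u v → u = r ∧ (v = h ∨ v ∈ L) ∨ u = h ∧ (v = r ∨ v ∈ L) ∨
    u ∈ L ∧ (v = r ∨ v = h ∨ v ∈ L ∧ L.ncard = 2)

theorem eq_of_ncard_eq_two {α : Type*} {L : Set α} (h : L.ncard = 2) {u v w : α} (hu : u ∈ L)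
    (hv : v ∈ L) (hw : w ∈ L) (hvu : u ≠ v) (hwu : u ≠ w) : v = w := by
  obtain ⟨x, y, -, rfl⟩ := Set.ncard_eq_two.1 h
  simp only [Set.mem_insert_iff, Set.mem_singleton_iff] at hu hv hw
  grind

/-- With both hubs in `D`, the edge `rh` takes the least colour of `A`, and a possible edge inside
`L` takes `d`. After these two are removed, `A` still has `L.ncard` colours for the crossing edges.
This suffices at the hubs, and also at the vertices of `L`, where two are needed. -/
theorem IsHub.exists_of_low [Finite V] {G : SimpleGraph V} {r h : V} {L : Set V}
    (hG : G.IsHub r h L) (A : Finset (Fin (d + 1))) (hA : L.ncard + 2 ≤ A.card) (a : Fin (d + 1))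
    (haA : a ∈ A) (hmin : ∀ b ∈ A, a ≤ b) (ha : 2 * (a : ℕ) ≤ d) :
    ∃ c : Sym2 V → Fin (d + 1), G.IsGalvinColouring {r, h} c ∧ ∀ v, G.Adj r v → c s(r, v) ∈ A := by
  obtain ⟨hrh, hrL, hhL, htwo, hadj⟩ := hG
  have hLD : ∀ l ∈ L, l ∉ ({r, h} : Set V) := by
    rintro l hl (rfl | rfl)
    exacts [hrL hl, hhL hl]
  have hD : ∀ u, u ∈ ({r, h} : Set V) ↔ u = r ∨ u = h := fun u => by simp
  let P := (A.erase a).erase (Fin.last d)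
  have hP : L.ncard ≤ P.card := by
    change L.ncard ≤ ((A.erase a).erase (Fin.last d)).card
    have h1 := Finset.card_erase_of_mem haA
    have h2 := Finset.pred_card_le_card_erase (s := A.erase a) (a := Fin.last d)
    omega
  have hPA : A ∩ P = P := Finset.inter_eq_right.2
    ((Finset.erase_subset _ _).trans (Finset.erase_subset _ _))
  have hdeg : ∀ u, {v | G.Adj u v ∧ (u ∈ ({r, h} : Set V) ↔ v ∉ ({r, h} : Set V))}.ncard ≤
      P.card := by
    intro u
    refine le_trans ?_ hP
    by_cases hu : u ∈ ({r, h} : Set V)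
    · refine Set.ncard_le_ncard (fun v hv => ?_) (Set.toFinite _)
      have h1 := hadj hv.1
      have h2 := hv.2
      rw [hD] at hu
      simp only [hD] at h2
      tauto
    · refine le_trans (Set.ncard_le_ncard (t := {r, h}) (fun v hv => ?_) (Set.toFinite _))
        ((Set.ncard_pair hrh).le.trans htwo)
      by_contra hv'
      exact hu (hv.2.2 hv')
  refine exists_isGalvinColouring_of_sinks {r, h} ?_ a (Fin.last d) ha (by simp; omega) P ?_ ?_
    hdeg r A (by simp) (by rw [hPA]; exact hdeg r) (fun _ _ _ => haA)
  · intro u v w huv huw hv hw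
    have hr' : r ∈ ({r, h} : Set V) := by simp
    have hh' : h ∈ ({r, h} : Set V) := by simp
    have hmono : ∀ x, G.Adj u x → (u ∈ ({r, h} : Set V) ↔ x ∈ ({r, h} : Set V)) →
        u = r ∧ x = h ∨ u = h ∧ x = r ∨ u ∈ L ∧ x ∈ L ∧ L.ncard = 2 := by
      intro x hux hx
      rcases hadj hux with ⟨rfl, h1 | h1⟩ | ⟨rfl, h1 | h1⟩ | ⟨h1, rfl | rfl | h2⟩
      · exact .inl ⟨rfl, h1⟩
      · exact absurd (hx.1 hr') (hLD x h1)
      · exact .inr (.inl ⟨rfl, h1⟩)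
      · exact absurd (hx.1 hh') (hLD x h1)
      · exact absurd (hx.2 hr') (hLD u h1)
      · exact absurd (hx.2 hh') (hLD u h1)
      · exact .inr (.inr ⟨h1, h2⟩)
    rcases hmono v huv hv with ⟨h1, h2⟩ | ⟨h1, h2⟩ | ⟨h1, h2, h3⟩ <;>
      rcases hmono w huw hw with ⟨h4, h5⟩ | ⟨h4, h5⟩ | ⟨h4, h5, h6⟩
    · rw [h2, h5]
    · exact absurd (h1.symm.trans h4) hrh
    · exact absurd (h1 ▸ h4) hrL
    · exact absurd (h4.symm.trans h1) hrh
    · rw [h2, h5]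
    · exact absurd (h1 ▸ h4) hhL
    · exact absurd (h4 ▸ h1) hrL
    · exact absurd (h4 ▸ h1) hhL
    · exact eq_of_ncard_eq_two h3 h1 h2 h5 huv.ne huw.ne
  · intro _ _ _ _ _ p hp
    have hp' := Finset.mem_of_mem_erase hp
    exact lt_of_le_of_ne (hmin p (Finset.mem_of_mem_erase hp')) (Finset.ne_of_mem_erase hp').symm
  · intro _ _ _ _ _ p hp
    exact Fin.lt_last_iff_ne_last.2 (Finset.ne_of_mem_erase hp)

/-- With only `r` in `D`, all colours can come from `A`, since they are large enough for edges
outside `D`. For `a 0 < ... < a (n + 1)` in `A` and `L = {l 1, ..., l n}`, the edge `rh` gets `a 0`,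
the edge from `r` to `l i` gets `a i`, and the edge from `h` to `l i` gets `a (i + 1)`. The edge
inside `L` of a 4-clique gets `a 0` again. -/
theorem IsHub.exists_of_high [Finite V] {G : SimpleGraph V} {r h : V} {L : Set V}
    (hG : G.IsHub r h L) (A : Finset (Fin (d + 1))) (hA : L.ncard + 2 ≤ A.card)
    (hhigh : ∀ b ∈ A, d ≤ 2 * (b : ℕ)) :
    ∃ c : Sym2 V → Fin (d + 1), G.IsGalvinColouring {r} c ∧ ∀ v, G.Adj r v → c s(r, v) ∈ A := by
  classical
  obtain ⟨hrh, hrL, hhL, htwo, hadj⟩ := hG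
  set n := L.ncard with hn
  obtain ⟨A', hA', hcard⟩ := Finset.exists_subset_card_eq hA
  let a : ℕ → Fin (d + 1) := fun i =>
    A'.orderEmbOfFin hcard ⟨i % (n + 2), Nat.mod_lt _ (by omega)⟩
  have haA : ∀ i, a i ∈ A := fun i => hA' (Finset.orderEmbOfFin_mem _ _ _)
  have halt : ∀ i j, i < j → j < n + 2 → a i < a j := fun i j hij hj => by
    simp only [a, OrderEmbedding.lt_iff_lt, Fin.mk_lt_mk]
    rwa [Nat.mod_eq_of_lt hj, Nat.mod_eq_of_lt (hij.trans hj)]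
  have hainj : ∀ i j, i < n + 2 → j < n + 2 → a i = a j → i = j := fun i j hi hj h => by
    rcases lt_trichotomy i j with h' | h' | h'
    exacts [absurd h (halt i j h' hj).ne, h', absurd h (halt j i h' hi).ne']
  obtain ⟨q, hqL, hqinj, hq0⟩ : ∃ q : V → ℕ, (∀ l ∈ L, 1 ≤ q l ∧ q l ≤ n) ∧
      (∀ l ∈ L, ∀ l' ∈ L, q l = q l' → l = l') ∧ ∀ v ∉ L, q v = 0 := by
    let ε : L ≃ Fin n := Finite.equivFinOfCardEq rfl
    refine ⟨fun v => if hv : v ∈ L then (ε ⟨v, hv⟩ : ℕ) + 1 else 0, fun l hl => ?_,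
      fun l hl l' hl' h => ?_, fun v hv => by simp [hv]⟩
    · have := (ε ⟨l, hl⟩).is_lt
      simp only [hl, dif_pos]
      omega
    · simp only [hl, hl', dif_pos, Nat.add_right_cancel_iff] at h
      simpa using ε.injective (Fin.ext h)
  -- One formula covers all edges: `q` vanishes at the hubs, and for `n = 2` the edge inside `L` has
  -- index `1 + 2 + 1 = n + 2`, which wraps around to `0`.
  let c : Sym2 V → Fin (d + 1) := Sym2.lift ⟨fun u v =>
    a (q u + q v + if u = r ∨ v = r then 0 else 1), fun u v => by
      simp only [or_comm, add_comm (q u)]⟩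
  have hlr : ∀ l ∈ L, l ≠ r := fun l hl h => hrL (h ▸ hl)
  have hc : ∀ u v, c s(u, v) = a (q u + q v + if u = r ∨ v = r then 0 else 1) := fun _ _ => rfl
  have hcrh : c s(r, h) = a 0 := by simp [hc, hq0 r hrL, hq0 h hhL]
  have hcrl : ∀ l, c s(r, l) = a (q l) := fun l => by simp [hc, hq0 r hrL]
  have hchl : ∀ l ∈ L, c s(h, l) = a (q l + 1) := fun l hl => by
    simp [hc, hq0 h hhL, hrh.symm, hlr l hl]
  have hcll : n = 2 → ∀ l ∈ L, ∀ l' ∈ L, l ≠ l' → c s(l, l') = a 0 := by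
    intro hn2 l hl l' hl' hne
    have h1 := hqL l hl
    have h2 := hqL l' hl'
    have h3 := mt (hqinj l hl l' hl') hne
    rw [hc, if_neg (by simp [hlr l hl, hlr l' hl'])]
    have h4 : q l + q l' + 1 = n + 2 := by omega
    simp only [a, h4, Nat.mod_self, Nat.zero_mod]
  have hchr : c s(h, r) = a 0 := Sym2.eq_swap ▸ hcrh
  have hclr : ∀ l, c s(l, r) = a (q l) := fun l => Sym2.eq_swap ▸ hcrl l
  have hclh : ∀ l ∈ L, c s(l, h) = a (q l + 1) := fun l hl => Sym2.eq_swap ▸ hchl l hl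
  have hproper : G.IsProperEdgeColouring c := by
    intro u v w huv huw heq
    rcases hadj huv with ⟨rfl, hv⟩ | ⟨rfl, hv⟩ | ⟨hu, hv⟩
    · have hw : w = h ∨ w ∈ L := by
        have := hadj huw
        tauto
      rw [hcrl, hcrl] at heq
      have hq : ∀ x, x = h ∨ x ∈ L → q x ≤ n ∧ (q x = 0 → x = h) := by
        rintro x (rfl | hx)
        · simp [hq0 x hhL]
        · have := hqL x hx
          exact ⟨this.2, fun h => by omega⟩
      have h1 := hq v hv
      have h2 := hq w hw
      have h3 := hainj _ _ (by omega) (by omega) heq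
      rcases hv with rfl | hv
      · rw [hq0 v hhL] at h3
        exact (h2.2 h3.symm).symm
      rcases hw with rfl | hw
      · rw [hq0 w hhL] at h3
        exact h1.2 h3
      exact hqinj v hv w hw h3
    · have hw : w = r ∨ w ∈ L := by
        have := hadj huw
        grind
      rcases hv with rfl | hv <;> rcases hw with rfl | hw
      · rfl
      · have := hqL w hw
        rw [hchr, hchl w hw] at heq
        have := hainj _ _ (by omega) (by omega) heq
        omega
      · have := hqL v hv
        rw [hchr, hchl v hv] at heq
        have := hainj _ _ (by omega) (by omega) heq
        omega
      · have := hqL w hw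
        have := hqL v hv
        rw [hchl w hw, hchl v hv] at heq
        have := hainj _ _ (by omega) (by omega) heq
        exact hqinj v hv w hw (by omega)
    · have hw : w = r ∨ w = h ∨ w ∈ L ∧ n = 2 := by
        have := hadj huw
        grind
      have hq := hqL u hu
      have hidx : ∀ x, G.Adj u x → (x = r ∨ x = h ∨ x ∈ L ∧ n = 2) →
          x = r ∧ c s(u, x) = a (q u) ∨ x = h ∧ c s(u, x) = a (q u + 1) ∨
          (x ∈ L ∧ n = 2) ∧ c s(u, x) = a 0 := by
        rintro x hux (rfl | rfl | hx)
        · exact .inl ⟨rfl, hclr u⟩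
        · exact .inr (.inl ⟨rfl, hclh u hu⟩)
        · exact .inr (.inr ⟨hx, hcll hx.2 u hu x hx.1 hux.ne⟩)
      have hne : ∀ i j, i < n + 2 → j < n + 2 → i ≠ j → a i ≠ a j := fun i j hi hj hij h =>
        hij (hainj i j hi hj h)
      have h1 := hne (q u) (q u + 1) (by omega) (by omega) (by omega)
      have h2 := hne (q u) 0 (by omega) (by omega) (by omega)
      have h3 := hne (q u + 1) 0 (by omega) (by omega) (by omega)
      rcases hidx v huv hv with ⟨hv, hcv⟩ | ⟨hv, hcv⟩ | ⟨hv, hcv⟩ <;>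
        rcases hidx w huw hw with ⟨hw, hcw⟩ | ⟨hw, hcw⟩ | ⟨hw, hcw⟩ <;>
        rw [hcv, hcw] at heq
      · rw [hv, hw]
      · exact absurd heq h1
      · exact absurd heq h2
      · exact absurd heq.symm h1
      · rw [hv, hw]
      · exact absurd heq h3
      · exact absurd heq.symm h2
      · exact absurd heq.symm h3
      · exact eq_of_ncard_eq_two hv.2 hu hv.1 hw.1 huv.ne huw.ne
  have hcA : ∀ e, c e ∈ A := by
    intro e
    induction e with
    | _ u v => exact haA _
  refine ⟨c, ⟨hproper, ?_, fun u v _ _ _ => hhigh _ (hcA _), ?_⟩, fun v _ => hcA _⟩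
  · rintro u v huv rfl rfl
    exact absurd rfl huv.ne
  · refine stablyPerfect_of_exists_sink fun S hS hSne => ?_
    have hrank : ∀ {v : V} {e f : Sym2 V}, (v = r ∧ c f < c e ∨ v ≠ r ∧ c e < c f) →
        galvinRank {r} c v f < galvinRank {r} c v e := fun h => galvinRank_lt_iff.2 h
    -- A sink is found in this order of priority: the edge from `h` to `L` with the largest colour,
    -- then `rh`, then the edge from `r` to `L` with the smallest colour, and finally the edge
    -- inside `L`.
    by_cases hhub : ∃ l ∈ L, s(h, l) ∈ S
    · obtain ⟨l, ⟨hl, hlS⟩, hmax⟩ := Set.exists_max_image {l | l ∈ L ∧ s(h, l) ∈ S} q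
        (Set.toFinite _) hhub
      have hql := hqL l hl
      refine ⟨s(h, l), hlS, fun e he hne v hv hve => hrank (.inr ?_)⟩
      rw [hchl l hl]
      obtain ⟨x, rfl⟩ := hve
      have hvx : G.Adj v x := hS he
      rcases Sym2.mem_iff.1 hv with rfl | rfl
      · refine ⟨hrh.symm, ?_⟩
        have hx : x = r ∨ x ∈ L := by
          have := hadj hvx
          grind
        rcases hx with rfl | hx
        · rw [hchr]
          exact halt _ _ (by omega) (by omega)
        · rw [hchl x hx]
          have h1 := hmax x ⟨hx, he⟩
          have h2 : q x ≠ q l := fun h => hne (by rw [hqinj x hx l hl h])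
          exact halt _ _ (by omega) (by omega)
      · refine ⟨hlr v hl, ?_⟩
        have hx : x = r ∨ x = h ∨ x ∈ L ∧ n = 2 := by
          have := hadj hvx
          grind
        rcases hx with rfl | rfl | hx
        · rw [hclr]
          exact halt _ _ (by omega) (by omega)
        · exact absurd Sym2.eq_swap hne
        · rw [hcll hx.2 v hl x hx.1 hvx.ne]
          exact halt _ _ (by omega) (by omega)
    have hnhub : ∀ l ∈ L, s(h, l) ∉ S := fun l hl hlS => hhub ⟨l, hl, hlS⟩
    have hnhub' : ∀ l ∈ L, s(l, h) ∉ S := fun l hl => Sym2.eq_swap ▸ hnhub l hl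
    by_cases hcen : s(r, h) ∈ S
    · refine ⟨s(r, h), hcen, fun e he hne v hv hve => hrank ?_⟩
      rw [hcrh]
      obtain ⟨x, rfl⟩ := hve
      have hvx : G.Adj v x := hS he
      rcases Sym2.mem_iff.1 hv with rfl | rfl
      · refine .inl ⟨rfl, ?_⟩
        have hx : x = h ∨ x ∈ L := by
          have := hadj hvx
          tauto
        rcases hx with rfl | hx
        · exact absurd rfl hne
        · have := hqL x hx
          rw [hcrl]
          exact halt _ _ (by omega) (by omega)
      · have hx : x = r ∨ x ∈ L := by
          have := hadj hvx
          grind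
        rcases hx with rfl | hx
        · exact absurd Sym2.eq_swap hne
        · exact absurd he (hnhub x hx)
    have hcen' : s(h, r) ∉ S := Sym2.eq_swap ▸ hcen
    by_cases hroot : ∃ l ∈ L, s(r, l) ∈ S
    · obtain ⟨l, ⟨hl, hlS⟩, hmin⟩ := Set.exists_min_image {l | l ∈ L ∧ s(r, l) ∈ S} q
        (Set.toFinite _) hroot
      have hql := hqL l hl
      refine ⟨s(r, l), hlS, fun e he hne v hv hve => hrank ?_⟩
      rw [hcrl l]
      obtain ⟨x, rfl⟩ := hve
      have hvx : G.Adj v x := hS he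
      rcases Sym2.mem_iff.1 hv with rfl | rfl
      · refine .inl ⟨rfl, ?_⟩
        have hx : x = h ∨ x ∈ L := by
          have := hadj hvx
          tauto
        rcases hx with rfl | hx
        · exact absurd he hcen
        · have h1 := hmin x ⟨hx, he⟩
          have h2 : q x ≠ q l := fun h => hne (by rw [hqinj x hx l hl h])
          have h3 := hqL x hx
          rw [hcrl]
          exact halt _ _ (by omega) (by omega)
      · refine .inr ⟨hlr v hl, ?_⟩
        have hx : x = r ∨ x = h ∨ x ∈ L ∧ n = 2 := by
          have := hadj hvx
          grind
        rcases hx with rfl | rfl | hx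
        · exact absurd Sym2.eq_swap hne
        · exact absurd he (hnhub' v hl)
        · rw [hcll hx.2 v hl x hx.1 hvx.ne]
          exact halt _ _ (by omega) (by omega)
    have hleaf : ∀ u v, s(u, v) ∈ S → u ∈ L ∧ v ∈ L ∧ n = 2 := by
      intro u v huv
      have hvu : s(v, u) ∈ S := Sym2.eq_swap ▸ huv
      have hr1 : ∀ l ∈ L, s(r, l) ∉ S := fun l hl hlS => hroot ⟨l, hl, hlS⟩
      rcases hadj (hS huv) with ⟨rfl, rfl | hv⟩ | ⟨rfl, rfl | hv⟩ | ⟨hu, rfl | rfl | hv⟩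
      · exact absurd huv hcen
      · exact absurd huv (hr1 v hv)
      · exact absurd huv hcen'
      · exact absurd huv (hnhub v hv)
      · exact absurd hvu (hr1 u hu)
      · exact absurd hvu (hnhub u hu)
      · exact ⟨hu, hv⟩
    obtain ⟨m, hm⟩ := hSne
    refine ⟨m, hm, fun e he hne v hvm hve => ?_⟩
    obtain ⟨x, rfl⟩ := hvm
    obtain ⟨y, rfl⟩ := hve
    obtain ⟨hv, hx, hn2⟩ := hleaf v x hm
    obtain ⟨-, hy, -⟩ := hleaf v y he
    have hxne : G.Adj v x := hS hm
    have hyne : G.Adj v y := hS he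
    exact absurd (by rw [eq_of_ncard_eq_two hn2 hv hx hy hxne.ne hyne.ne]) hne

/-- Either the least colour of `A` is small enough for an edge inside `D`, or all colours of `A` are
large enough for edges outside `D`. -/
theorem IsHub.exists_isGalvinColouring [Finite V] {G : SimpleGraph V} {r h : V} {L : Set V}
    (hG : G.IsHub r h L) (A : Finset (Fin (d + 1))) (hA : L.ncard + 2 ≤ A.card) :
    ∃ (D : Set V) (c : Sym2 V → Fin (d + 1)), r ∈ D ∧ G.IsGalvinColouring D c ∧
      ∀ v, G.Adj r v → c s(r, v) ∈ A := by
  have hne : A.Nonempty := Finset.card_pos.1 (by omega)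
  by_cases ha : 2 * (A.min' hne : ℕ) ≤ d
  · obtain ⟨c, hc⟩ := hG.exists_of_low A hA _ (A.min'_mem hne) (fun b hb => A.min'_le b hb) ha
    exact ⟨_, c, by simp, hc⟩
  · obtain ⟨c, hc⟩ := hG.exists_of_high A hA fun b hb => by
      have : (A.min' hne : ℕ) ≤ b := A.min'_le b hb
      omega
    exact ⟨{r}, c, rfl, hc⟩

end SimpleGraph

/-! ### The rooted theorem and the orientation -/

namespace SimpleGraph

variable {V : Type*} {d : ℕ}

theorem isGalvinColouring_bot (D : Set V) (c : Sym2 V → Fin (d + 1)) :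
    (⊥ : SimpleGraph V).IsGalvinColouring D c where
  proper _ _ _ h := absurd h (by simp)
  low _ _ h := absurd h (by simp)
  high _ _ h := absurd h (by simp)
  perfect S hS := ⟨∅, by simp, by simp, fun e he => absurd (hS he) (by simp)⟩

/-- An isolated root imposes nothing on the colours and can be moved into `D` after colouring from
another root. -/
theorem rootedGalvinColourable_of_forall_adj {G : SimpleGraph V}
    (hdeg : ∀ u, (G.neighborSet u).ncard ≤ d)
    (h : ∀ (r x : V) (A : Finset (Fin (d + 1))), G.Adj r x → (G.neighborSet r).ncard < A.card →
      ∃ (D : Set V) (c : Sym2 V → Fin (d + 1)), r ∈ D ∧ G.IsGalvinColouring D c ∧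
        ∀ v, G.Adj r v → c s(r, v) ∈ A) :
    G.RootedGalvinColourable d := by
  intro r A hA
  by_cases hr : ∃ x, G.Adj r x
  · obtain ⟨x, hx⟩ := hr
    exact h r x A hx hA
  push Not at hr
  by_cases hG : ∃ u v, G.Adj u v
  · obtain ⟨u, v, huv⟩ := hG
    obtain ⟨D, c, -, hc, -⟩ := h u v Finset.univ huv (by simpa using Nat.lt_succ_of_le (hdeg u))
    refine ⟨insert r D, c, by simp, hc.congr (fun a b hab => ?_) fun _ _ _ => rfl,
      fun v hv => absurd hv (hr v)⟩
    have hne : a ≠ r := fun hra => hr b (hra ▸ hab)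
    simp [hne]
  · push Not at hG
    obtain rfl : G = ⊥ := by
      ext u v
      simpa using hG u v
    exact ⟨Set.univ, fun _ => 0, trivial, isGalvinColouring_bot _ _, fun v hv => absurd hv (hr v)⟩

theorem rootedGalvinColourable_of_colorable_two [Finite V] {G : SimpleGraph V}
    (hG : G.Colorable 2) (hdeg : ∀ u, (G.neighborSet u).ncard ≤ d) :
    G.RootedGalvinColourable d := by
  obtain ⟨col⟩ := hG
  intro r A hA
  have key : ∀ u v, G.Adj u v → col u = col r → col v ≠ col r := fun u v huv hu hv =>
    col.valid huv (hu.trans hv.symm)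
  have hU : ∀ u v, G.Adj u v → col u ≠ col r → ¬ col v ≠ col r := fun u v huv hu hv => by
    have hne := col.valid huv
    omega
  obtain ⟨c, hc⟩ := exists_isGalvinColouring_of_indep {v | col v = col r} key
    (fun u v w huv _ hu hv _ => absurd hv (hU u v huv hu)) hdeg r rfl A hA
  exact ⟨{v | col v = col r}, c, rfl, hc⟩

/-- By symmetry any neighbour of the root can act as the second hub; the root has degree three, so
`A` has at least four colours. -/
theorem IsFourClique.rootedGalvinColourable [Finite V] {G : SimpleGraph V} {W : Finset V}
    (hW : G.IsFourClique W) (hdeg : ∀ u, (G.neighborSet u).ncard ≤ d) :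
    G.RootedGalvinColourable d := by
  classical
  refine rootedGalvinColourable_of_forall_adj hdeg fun r h A hrh hA => ?_
  obtain ⟨⟨hcl, hcard⟩, hadj⟩ := hW
  obtain ⟨hr, hh⟩ := hadj r h hrh
  let L : Finset V := (W.erase r).erase h
  have hL : L.card = 2 := by
    rw [Finset.card_erase_of_mem (Finset.mem_erase.2 ⟨hrh.ne', hh⟩), Finset.card_erase_of_mem hr,
      hcard]
  have hLc : (L : Set V).ncard = 2 := by rw [Set.ncard_coe_finset, hL]
  have hmem : ∀ x, x ∈ L ↔ x ≠ h ∧ x ≠ r ∧ x ∈ W := fun x => by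
    simp [L]
  have hhub : G.IsHub r h L := by
    refine ⟨hrh.ne, by simp [hmem], by simp [hmem], hLc.ge, fun u v huv => ?_⟩
    have hne := huv.ne
    obtain ⟨hu, hv⟩ := hadj u v huv
    simp only [Finset.mem_coe, hmem, hLc]
    by_cases h1 : u = r
    · subst h1
      have := hne.symm
      tauto
    by_cases h2 : u = h
    · subst h2
      have := hne.symm
      tauto
    tauto
  have h3 : 3 ≤ (G.neighborSet r).ncard := by
    have : (W.erase r).card = 3 := by rw [Finset.card_erase_of_mem hr, hcard]
    rw [← this, ← Set.ncard_coe_finset]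
    refine Set.ncard_le_ncard (fun x hx => ?_) (Set.toFinite _)
    have hx' := Finset.mem_erase.1 hx
    exact hcl hr hx'.2 hx'.1.symm
  exact hhub.exists_isGalvinColouring A (by omega)

theorem IsTriangleBook.swap {G : SimpleGraph V} {a b : V} {L : Set V}
    (h : G.IsTriangleBook a b L) : G.IsTriangleBook b a L := by
  obtain ⟨hab, hne, hL, hadj⟩ := h
  refine ⟨hab.symm, hne, fun l hl => (hL l hl).symm, fun u v huv => ?_⟩
  have := hadj u v huv
  tauto

theorem IsTriangleBook.exists_of_hub [Finite V] {G : SimpleGraph V} {a b : V} {L : Set V}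
    (h : G.IsTriangleBook a b L) (hdeg : ∀ u, (G.neighborSet u).ncard ≤ d)
    (A : Finset (Fin (d + 1))) (hA : (G.neighborSet a).ncard < A.card) :
    ∃ (D : Set V) (c : Sym2 V → Fin (d + 1)), a ∈ D ∧ G.IsGalvinColouring D c ∧
      ∀ v, G.Adj a v → c s(a, v) ∈ A := by
  obtain ⟨hab, hne, hL, hadj⟩ := h
  have ha : a ∉ L := fun h => (hL a h).1.ne rfl
  have hb : b ∉ L := fun h => (hL b h).2.ne rfl
  by_cases h2 : 2 ≤ L.ncard
  · have hhub : G.IsHub a b L := by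
      refine ⟨hab.ne, ha, hb, h2, fun u v huv => ?_⟩
      have hne := huv.ne
      have := hadj u v huv
      grind
    refine hhub.exists_isGalvinColouring A ?_
    have hsub : insert b L ⊆ G.neighborSet a := by
      rintro x (rfl | hx)
      exacts [hab, (hL x hx).1]
    have := Set.ncard_le_ncard hsub (Set.toFinite _)
    rw [Set.ncard_insert_of_notMem hb (Set.toFinite _)] at this
    omega
  -- In a single triangle, `D = {a}` is independent and leaves only the edge `bl` outside.
  · obtain ⟨l, rfl⟩ : ∃ l, L = {l} := by
      rw [← Set.ncard_eq_one]
      have := (Set.ncard_pos (Set.toFinite L)).2 hne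
      omega
    have hmatch : ∀ u v w, G.Adj u v → G.Adj u w → u ∉ ({a} : Set V) → v ∉ ({a} : Set V) →
        w ∉ ({a} : Set V) → v = w := by
      intro u v w huv huw hu hv hw
      have h3 := hadj u v huv
      have h4 := hadj u w huw
      have h5 := huv.ne
      have h6 := huw.ne
      simp only [Set.mem_singleton_iff] at *
      grind
    obtain ⟨c, hc⟩ := exists_isGalvinColouring_of_indep {a} (fun u v huv hu hv =>
      huv.ne (hu.trans hv.symm)) hmatch hdeg a rfl A hA
    exact ⟨{a}, c, rfl, hc⟩

theorem IsTriangleBook.rootedGalvinColourable [Finite V] {G : SimpleGraph V} {a b : V} {L : Set V}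
    (h : G.IsTriangleBook a b L) (hdeg : ∀ u, (G.neighborSet u).ncard ≤ d) :
    G.RootedGalvinColourable d := by
  refine rootedGalvinColourable_of_forall_adj hdeg fun r x A hrx hA => ?_
  by_cases hra : r = a
  · subst hra
    exact h.exists_of_hub hdeg A hA
  by_cases hrb : r = b
  · subst hrb
    exact h.swap.exists_of_hub hdeg A hA
  obtain ⟨hab, hne, hL, hadj⟩ := h
  have ha : a ∉ L := fun h => (hL a h).1.ne rfl
  have hb : b ∉ L := fun h => (hL b h).2.ne rfl
  -- For a root in `L`, the set `L` itself serves as `D`: it is independent, and `ab` is the only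
  -- edge outside it.
  have hrL : r ∈ L := by
    have := hadj r x hrx
    tauto
  have hindep : ∀ u v, G.Adj u v → u ∈ L → v ∉ L := by
    intro u v huv hu hv
    have := hadj u v huv
    grind
  have hmatch : ∀ u v w, G.Adj u v → G.Adj u w → u ∉ L → v ∉ L → w ∉ L → v = w := by
    intro u v w huv huw hu hv hw
    have h3 := hadj u v huv
    have h4 := hadj u w huw
    have h5 := huv.ne
    have h6 := huw.ne
    grind
  obtain ⟨c, hc⟩ := exists_isGalvinColouring_of_indep L hindep hmatch hdeg r hrL A hA
  exact ⟨L, c, hrL, hc⟩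

theorem OddCyclesAreTriangles.rootedGalvinColourable [Finite V] {G : SimpleGraph V}
    (h : G.OddCyclesAreTriangles) (hdeg : ∀ u, (G.neighborSet u).ncard ≤ d) :
    G.RootedGalvinColourable d := by
  induction hn : G.edgeSet.ncard using Nat.strong_induction_on generalizing G with
  | _ n ih =>
    rcases h.structure with hG | ⟨W, hW⟩ | ⟨a, b, L, hL⟩ | ⟨G₁, G₂, v, hsep⟩
    · exact rootedGalvinColourable_of_colorable_two hG hdeg
    · exact hW.rootedGalvinColourable hdeg
    · exact hL.rootedGalvinColourable hdeg
    · have hsmall : ∀ {H H' : SimpleGraph V}, G.IsSeparation H H' v →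
          H.RootedGalvinColourable d := by
        intro H H' hs
        have hHG : H ≤ G := hs.1 ▸ le_sup_left
        refine ih _ ?_ (h.mono hHG) (fun u => ?_) rfl
        · rw [← hn]
          refine Set.ncard_lt_ncard (edgeSet_ssubset_edgeSet.2 (lt_of_le_of_ne hHG ?_))
            (Set.toFinite _)
          rintro rfl
          refine hs.2.2.1 ?_
          ext x y
          refine ⟨fun hxy => ?_, fun hxy => absurd hxy (by simp)⟩
          have hH : H.Adj x y := hs.1 ▸ (Or.inr hxy : (H ⊔ H').Adj x y)
          exact absurd hxy (hs.not_adj hH)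
        · exact (Set.ncard_le_ncard (fun x hx => hHG hx) (Set.toFinite _)).trans (hdeg u)
      exact hsep.rootedGalvinColourable hdeg (hsmall hsep) (hsmall hsep.symm)

/-- The out-neighbours of an edge through an end `w` have distinct ranks at `w` below its own, so
its outdegree is at most the sum of its ranks. This sum is `d` across the partition, `2c` inside `D`
and `2(d - c)` outside, hence at most `d` by `low` and `high`. -/
theorem IsGalvinColouring.hasProperGalvinOrientation {G : SimpleGraph V} {D : Set V}
    {c : Sym2 V → Fin (d + 1)} (h : G.IsGalvinColouring D c) :
    G.HasProperGalvinOrientation (d + 1) := by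
  have hinj : ∀ (v : V) (e f : G.edgeSet), v ∈ (e : Sym2 V) → v ∈ (f : Sym2 V) →
      c e = c f → e = f := by
    rintro v ⟨_, he⟩ ⟨_, hf⟩ ⟨x, rfl⟩ ⟨y, rfl⟩ hcef
    exact Subtype.ext (congrArg (fun z => s(v, z)) (h.proper he hf hcef))
  let φ : G.EdgeColouring (d + 1) := Coloring.mk (fun e => c e) fun {e f} hef hc => by
    obtain ⟨hne, v, hve, hvf⟩ := lineGraph_adj_iff_exists.1 hef
    exact hne (hinj v e f hve hvf hc)
  have hadj : ∀ e f, (G.galvinOrientation Dᶜ D φ).Adj e f ↔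
      ∃ v, v ∈ (e : Sym2 V) ∧ v ∈ (f : Sym2 V) ∧ galvinRank D c v f < galvinRank D c v e := by
    intro e f
    simp only [galvinRank_lt_iff]
    rfl
  refine ⟨Dᶜ, D, φ, disjoint_compl_left, Set.compl_union_self D, fun S => ?_, fun e => ?_⟩
  · obtain ⟨K, hKS, hK, hdom⟩ := h.perfect (Subtype.val '' S) (by simp)
    refine ⟨{e | (e : Sym2 V) ∈ K}, fun e he f hf hef => ?_, fun e he => ?_⟩
    · obtain ⟨v, hve, hvf, hlt⟩ := (hadj e f).1 hef
      rw [hK _ he _ hf v hve hvf] at hlt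
      exact hlt.ne rfl
    · obtain ⟨f, hf, hh⟩ := hdom e ⟨_, e.2, rfl⟩ he
      obtain ⟨f, hfS, rfl⟩ := hKS hf
      exact ⟨⟨f, hfS⟩, hf, (hadj e f).2 hh⟩
  · obtain ⟨e, he⟩ := e
    induction e with
    | _ u v =>
      have huv : G.Adj u v := he
      let N : V → Set G.edgeSet := fun w =>
        {f | w ∈ (f : Sym2 V) ∧ galvinRank D c w f < galvinRank D c w s(u, v)}
      have hN : ∀ w, (N w).encard ≤ (galvinRank D c w s(u, v) : ℕ∞) := by
        intro w
        have hcard : (Finset.range (galvinRank D c w s(u, v)) : Set ℕ).encard =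
            (galvinRank D c w s(u, v) : ℕ∞) := by
          rw [Set.encard_coe_eq_coe_finsetCard, Finset.card_range]
        rw [← hcard]
        refine Set.encard_le_encard_of_injOn (f := fun f : G.edgeSet => galvinRank D c w f)
          (fun f hf => by simpa using hf.2) fun f hf g hg hfg => ?_
        exact hinj w f g hf.1 hg.1 (eq_of_galvinRank_eq hfg)
      have hsub : {f | (G.galvinOrientation Dᶜ D φ).Adj ⟨s(u, v), he⟩ f} ⊆ N u ∪ N v := by
        intro f hf
        obtain ⟨w, hw, hwf, hlt⟩ := (hadj _ _).1 hf
        rcases Sym2.mem_iff.1 hw with rfl | rfl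
        exacts [.inl ⟨hwf, hlt⟩, .inr ⟨hwf, hlt⟩]
      have hsum : galvinRank D c u s(u, v) + galvinRank D c v s(u, v) ≤ d := by
        have hle := (c s(u, v)).is_le
        have hlow := h.low huv
        have hhigh := h.high huv
        by_cases hu : u ∈ D <;> by_cases hv : v ∈ D <;>
          simp only [galvinRank, hu, hv, if_true, if_false, not_true, not_false_iff, true_imp_iff,
            false_imp_iff] at hlow hhigh ⊢ <;> omega
      calc _ ≤ (N u ∪ N v).encard := Set.encard_le_encard hsub
        _ ≤ (N u).encard + (N v).encard := Set.encard_union_le _ _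
        _ ≤ galvinRank D c u s(u, v) + galvinRank D c v s(u, v) := add_le_add (hN u) (hN v)
        _ ≤ ((d + 1 - 1 : ℕ) : ℕ∞) := by exact_mod_cast hsum

end SimpleGraph

theorem theorem8 {V : Type*} [Fintype V] (G : SimpleGraph V) [DecidableRel G.Adj]
    (hG : ∀ (v : V) (c : G.Walk v v), c.IsCycle → Odd c.length → c.length < 5) :
    G.HasProperGalvinOrientation (G.maxDegree + 1) := by
  have hdeg : ∀ u, (G.neighborSet u).ncard ≤ G.maxDegree := fun u => by
    rw [Set.ncard_eq_toFinset_card']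
    exact G.degree_le_maxDegree u
  obtain ⟨D, c, hc⟩ : ∃ (D : Set V) (c : Sym2 V → Fin (G.maxDegree + 1)),
      G.IsGalvinColouring D c := by
    -- The rooted statement needs a vertex as root, so the empty graph is treated apart.
    rcases isEmpty_or_nonempty V with _ | ⟨⟨r⟩⟩
    · refine ⟨∅, fun _ => 0, ?_⟩
      convert SimpleGraph.isGalvinColouring_bot (V := V) ∅ fun _ => 0
      exact Subsingleton.elim _ _
    · obtain ⟨D, c, -, hc, -⟩ :=
        (SimpleGraph.oddCyclesAreTriangles_of_isCycle hG).rootedGalvinColourable hdeg r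
          Finset.univ (by simpa using Nat.lt_succ_of_le (hdeg r))
      exact ⟨D, c, hc⟩
  exact hc.hasProperGalvinOrientation
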